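/- A geometric graph on $n$ vertices is a simple graph whose vertices are $n$ distinct points in general position in the plane (no three on a line) and whose edges are the straight line segments joining adjacent vertices. Two distinct edges cross if their interiors intersect; let $\mathrm{crs}(G)$ be the number of unordered pairs of distinct edges of $G$ that cross. **Theorem.** There is an algorithm on the real RAM that, given any geometric graph $G$ on $n$ vertices, by the coordinates of its vertices and its adjacency matrix, computes $\mathrm{crs}(G)$ in $O(n^2 \log n)$ time in the worst case. Here the real RAM performs arithmetic operations $(+,-,\times,/)$ on and comparisons of real numbers, operations on and comparisons of integer words of $O(\log n)$ bits, and memory accesses (addressed by words), each at unit cost; it cannot round a real number or convert it to a word. -/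

import Mathlib

open Filter Asymptotics

/-! Geometric graphs and their crossings. -/

/-- A geometric graph on `n` vertices: a simple graph whose vertices are pairwise distinct points of
the Euclidean plane, no three of them on a line, and whose edges are the straight line segments
joining adjacent vertices. -/
structure GeometricGraph (n : ℕ) where
  point : Fin n → EuclideanSpace ℝ (Fin 2)
  graph : SimpleGraph (Fin n)
  point_injective : Function.Injective point
  not_collinear : ∀ i j k : Fin n, i ≠ j → i ≠ k → j ≠ k →
    ¬ Collinear ℝ {point i, point j, point k}

namespace GeometricGraph

variable {n : ℕ}

/-- The interior of the segment that represents the pair `e` of vertices. -/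
def edgeInterior (G : GeometricGraph n) (e : Sym2 (Fin n)) : Set (EuclideanSpace ℝ (Fin 2)) :=
  Sym2.lift ⟨fun u v => openSegment ℝ (G.point u) (G.point v),
    fun _ _ => openSegment_symm ℝ _ _⟩ e

/-- Two edges cross if they intersect in their interiors. -/
def Cross (G : GeometricGraph n) (e f : Sym2 (Fin n)) : Prop :=
  (G.edgeInterior e ∩ G.edgeInterior f).Nonempty

/-- The number of unordered pairs of distinct edges of `G` that cross. -/
noncomputable def crossings (G : GeometricGraph n) : ℕ :=
  Set.ncard {P : Sym2 (Sym2 (Fin n)) |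
    ∃ e ∈ G.graph.edgeSet, ∃ f ∈ G.graph.edgeSet, e ≠ f ∧ G.Cross e f ∧ P = s(e, f)}

end GeometricGraph

/-! The real RAM: a random access machine that stores words (natural numbers below a bound `W`) and
real numbers, in separate registers and arrays. Each arithmetic operation, comparison and memory
access takes one unit of time. Reals can be compared, but cannot be rounded or converted to words;
addresses are words. -/

namespace RealRAM

/-- A memory configuration. Registers and arrays are named by natural numbers. A fixed program
mentions finitely many of them. `wmem a k` and `rmem a k` are the entries with index `k` of the
word array and the real array named `a`. -/
structure State where
  wreg : ℕ → ℕ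
  rreg : ℕ → ℝ
  wmem : ℕ → ℕ → ℕ
  rmem : ℕ → ℕ → ℝ

/-- Word operations; subtraction is truncated at `0`, division is rounded down. -/
inductive WordOp where
  | add | sub | mul | div

/-- Real operations. -/
inductive RealOp where
  | add | sub | mul | div

/-- The value of a word operation; division by zero is undefined. -/
def WordOp.eval : WordOp → ℕ → ℕ → Option ℕ
  | .add, x, y => some (x + y)
  | .sub, x, y => some (x - y)
  | .mul, x, y => some (x * y)
  | .div, x, y => if y = 0 then none else some (x / y)

open Classical in
/-- The value of a real operation; division by zero is undefined. -/
noncomputable def RealOp.eval : RealOp → ℝ → ℝ → Option ℝ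
  | .add, x, y => some (x + y)
  | .sub, x, y => some (x - y)
  | .mul, x, y => some (x * y)
  | .div, x, y => if y = 0 then none else some (x / y)

/-- Elementary instructions. The operands `d`, `i`, `j`, `r` are names of registers and `a` is the
name of an array. -/
inductive Instr where
  /-- word register `d` := the constant `k` -/
  | wconst (d k : ℕ)
  /-- word register `d` := word register `i` op word register `j` -/
  | wop (op : WordOp) (d i j : ℕ)
  /-- word register `d` := `a[i]`, the index being the content of word register `i` -/
  | wload (d a i : ℕ)
  /-- `a[i]` := word register `r`, the index being the content of word register `i` -/
  | wstore (a i r : ℕ)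
  /-- real register `d` := the content of word register `i`, as a real number -/
  | rcast (d i : ℕ)
  /-- real register `d` := real register `i` op real register `j` -/
  | rop (op : RealOp) (d i j : ℕ)
  /-- real register `d` := `a[i]`, the index being the content of word register `i` -/
  | rload (d a i : ℕ)
  /-- `a[i]` := real register `r`, the index being the content of word register `i` -/
  | rstore (a i r : ℕ)

/-- Write the word `v` to register `d`; this fails if `v` does not fit into a word. -/
def State.setWord (W : ℕ) (s : State) (d v : ℕ) : Option State :=
  if v < W then some { s with wreg := Function.update s.wreg d v } else none

/-- Write the real number `v` to register `d`. -/
def State.setReal (s : State) (d : ℕ) (v : ℝ) : State :=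
  { s with rreg := Function.update s.rreg d v }

/-- The effect of an instruction on a machine with words below `W`; `none` means that the machine
gets stuck (overflow or division by zero), and then the run never ends. -/
noncomputable def Instr.exec (W : ℕ) (s : State) : Instr → Option State
  | .wconst d k => s.setWord W d k
  | .wop op d i j => (op.eval (s.wreg i) (s.wreg j)).bind (s.setWord W d)
  | .wload d a i => s.setWord W d (s.wmem a (s.wreg i))
  | .wstore a i r => some { s with
      wmem := Function.update s.wmem a (Function.update (s.wmem a) (s.wreg i) (s.wreg r)) }
  | .rcast d i => some (s.setReal d (s.wreg i))
  | .rop op d i j => (op.eval (s.rreg i) (s.rreg j)).map (s.setReal d)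
  | .rload d a i => some (s.setReal d (s.rmem a (s.wreg i)))
  | .rstore a i r => some { s with
      rmem := Function.update s.rmem a (Function.update (s.rmem a) (s.wreg i) (s.rreg r)) }

/-- Tests: comparisons of two word registers or of two real registers. -/
inductive Test where
  | wlt (i j : ℕ)
  | weq (i j : ℕ)
  | rlt (i j : ℕ)
  | req (i j : ℕ)

/-- The test succeeds in the given state. -/
def Test.Holds (s : State) : Test → Prop
  | .wlt i j => s.wreg i < s.wreg j
  | .weq i j => s.wreg i = s.wreg j
  | .rlt i j => s.rreg i < s.rreg j
  | .req i j => s.rreg i = s.rreg j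

/-- Programs. -/
inductive Program where
  | skip
  | instr (c : Instr)
  | seq (p q : Program)
  | ifThenElse (b : Test) (p q : Program)
  | whileDo (b : Test) (p : Program)

/-- `Runs W p s t s'`: on a machine with words below `W`, the program `p` started in state `s`
halts after exactly `t` units of time in state `s'`. Every instruction and every evaluation of a
test takes one unit. -/
inductive Runs (W : ℕ) : Program → State → ℕ → State → Prop where
  | skip (s : State) : Runs W .skip s 0 s
  | instr {c : Instr} {s s' : State} (h : c.exec W s = some s') : Runs W (.instr c) s 1 s'
  | seq {p q : Program} {s s' s'' : State} {t t' : ℕ}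
      (h : Runs W p s t s') (h' : Runs W q s' t' s'') : Runs W (.seq p q) s (t + t') s''
  | ifTrue {b : Test} {p q : Program} {s s' : State} {t : ℕ}
      (hb : b.Holds s) (h : Runs W p s t s') : Runs W (.ifThenElse b p q) s (t + 1) s'
  | ifFalse {b : Test} {p q : Program} {s s' : State} {t : ℕ}
      (hb : ¬ b.Holds s) (h : Runs W q s t s') : Runs W (.ifThenElse b p q) s (t + 1) s'
  | whileTrue {b : Test} {p : Program} {s s' s'' : State} {t t' : ℕ}
      (hb : b.Holds s) (h : Runs W p s t s') (h' : Runs W (.whileDo b p) s' t' s'') :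
      Runs W (.whileDo b p) s (t + t' + 1) s''
  | whileFalse {b : Test} {p : Program} {s : State}
      (hb : ¬ b.Holds s) : Runs W (.whileDo b p) s 1 s

open Classical in
/-- The initial state on input `G`: word register `0` holds `n`, word array `0` holds the adjacency
matrix of `G` row by row, real arrays `0` and `1` hold the two lists of coordinates of the vertices;
everything else is `0`. -/
noncomputable def input {n : ℕ} (G : GeometricGraph n) : State where
  wreg := fun i => if i = 0 then n else 0
  rreg := fun _ => 0
  wmem := fun a k =>
    if a = 0 ∧ ∃ i j : Fin n, k = (i : ℕ) * n + (j : ℕ) ∧ G.graph.Adj i j then 1 else 0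
  rmem := fun a k =>
    if h : k < n then
      if a = 0 then G.point ⟨k, h⟩ 0 else if a = 1 then G.point ⟨k, h⟩ 1 else 0
    else 0

end RealRAM

/-! For edges `vu` and `wx` with `v ≠ w`, take `1` if `u` and `x` lie on the same side of the line
through `v` and `w`, `-1` if they lie on opposite sides, and `0` if one of them is on the line. The
sum over the four ways to orient the two edges is `4` if the edges cross, `1` if they have exactly
one vertex in common, and `0` otherwise. Hence the sum over all pairs of oriented edges is eight
times the number of crossings plus the sum of `deg v * (deg v - 1)` over the vertices `v`.

Grouped by the starting points, this sum is determined by the numbers of neighbours of `v` on the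
two sides of the line through `v` and `w`, for all `v` and `w`. For fixed `v`, these are found in
`O(n * log n)` time by sorting the lines through `v` and the other points by slope, and rotating a
line past all of them. -/

/-- Twice the signed area of the triangle `p q r`: it is positive if `p`, `q`, `r` are in
counterclockwise order, and zero if they are collinear. -/
def orient (p q r : EuclideanSpace ℝ (Fin 2)) : ℝ :=
  (q 0 - p 0) * (r 1 - p 1) - (q 1 - p 1) * (r 0 - p 0)

section Orient

variable {a b c d p q r : EuclideanSpace ℝ (Fin 2)}

theorem orient_swap_left (p q r : EuclideanSpace ℝ (Fin 2)) : orient q p r = -orient p q r := by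
  simp only [orient]; ring

theorem orient_swap_right (p q r : EuclideanSpace ℝ (Fin 2)) : orient p r q = -orient p q r := by
  simp only [orient]; ring

theorem collinear_of_orient_eq_zero (h : orient p q r = 0) : Collinear ℝ {p, q, r} := by
  obtain rfl | hpq := eq_or_ne p q
  · simpa using collinear_pair ℝ p r
  have hN : (q 0 - p 0) ^ 2 + (q 1 - p 1) ^ 2 ≠ 0 := fun hN => hpq <| by
    ext i
    fin_cases i <;> simp only [Fin.zero_eta, Fin.mk_one] <;>
      nlinarith [sq_nonneg (q 0 - p 0), sq_nonneg (q 1 - p 1)]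
  -- `r - p` is its own orthogonal projection onto the direction `q - p`.
  rw [collinear_iff_of_mem (p₀ := p) (by simp)]
  refine ⟨q - p, ?_⟩
  rintro x (rfl | rfl | rfl)
  · exact ⟨0, by simp⟩
  · exact ⟨1, by simp⟩
  · refine ⟨((x 0 - p 0) * (q 0 - p 0) + (x 1 - p 1) * (q 1 - p 1)) /
      ((q 0 - p 0) ^ 2 + (q 1 - p 1) ^ 2), ?_⟩
    simp only [orient] at h
    ext i
    fin_cases i <;>
      simp only [Fin.zero_eta, Fin.mk_one, vadd_eq_add, PiLp.add_apply, PiLp.smul_apply,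
        PiLp.sub_apply, smul_eq_mul] <;> field_simp
    · linear_combination -(q 1 - p 1) * h
    · linear_combination (q 0 - p 0) * h

theorem zero_mem_openSegment_iff {x y : ℝ} (hx : x ≠ 0) :
    (0 : ℝ) ∈ openSegment ℝ x y ↔ x * y < 0 := by
  obtain rfl | hxy := eq_or_ne x y
  · simp [hx.symm, mul_self_nonneg]
  · rw [openSegment_eq_Ioo' hxy, Set.mem_Ioo, inf_lt_iff, lt_sup_iff, mul_neg_iff]
    have := hx.lt_or_gt
    grind

theorem orient_eq_zero_of_mem_openSegment (h : p ∈ openSegment ℝ a b) : orient a b p = 0 := by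
  obtain ⟨s, t, -, -, hst, rfl⟩ := h
  obtain rfl : s = 1 - t := by linarith
  simp only [orient, PiLp.add_apply, PiLp.smul_apply, smul_eq_mul]
  ring

theorem orient_mem_openSegment (a b : EuclideanSpace ℝ (Fin 2)) (h : p ∈ openSegment ℝ c d) :
    orient a b p ∈ openSegment ℝ (orient a b c) (orient a b d) := by
  obtain ⟨s, t, hs, ht, hst, rfl⟩ := h
  refine ⟨s, t, hs, ht, hst, ?_⟩
  obtain rfl : s = 1 - t := by linarith
  simp only [orient, PiLp.add_apply, PiLp.smul_apply, smul_eq_mul]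
  ring

theorem mul_orient_neg_of_mem_openSegment (hc : orient a b c ≠ 0) (hab : p ∈ openSegment ℝ a b)
    (hcd : p ∈ openSegment ℝ c d) : orient a b c * orient a b d < 0 := by
  rw [← zero_mem_openSegment_iff hc, ← orient_eq_zero_of_mem_openSegment hab]
  exact orient_mem_openSegment a b hcd

theorem openSegment_inter_openSegment_nonempty (hcd : orient a b c * orient a b d < 0)
    (hab : orient c d a * orient c d b < 0) :
    (openSegment ℝ a b ∩ openSegment ℝ c d).Nonempty := by
  obtain ⟨s, t, hs, ht, hst, hz⟩ := (zero_mem_openSegment_iff (left_ne_zero_of_mul hab.ne)).2 hab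
  obtain ⟨s', t', hs', ht', hst', hz'⟩ :=
    (zero_mem_openSegment_iff (left_ne_zero_of_mul hcd.ne)).2 hcd
  have hD : orient a b d - orient a b c ≠ 0 := fun h => by
    rw [sub_eq_zero.1 h] at hcd
    exact hcd.not_ge (mul_self_nonneg _)
  refine ⟨s • a + t • b, ⟨s, t, hs, ht, hst, rfl⟩, s', t', hs', ht', hst', ?_⟩
  obtain rfl : s = 1 - t := by linarith
  obtain rfl : s' = 1 - t' := by linarith
  -- Cramer's rule
  ext i
  refine mul_left_cancel₀ hD ?_
  fin_cases i <;>
    simp only [Fin.zero_eta, Fin.mk_one, PiLp.add_apply, PiLp.smul_apply, smul_eq_mul, orient]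
      at hz hz' ⊢
  · linear_combination (d 0 - c 0) * hz' + (b 0 - a 0) * hz
  · linear_combination (d 1 - c 1) * hz' + (b 1 - a 1) * hz

theorem openSegment_inter_openSegment_nonempty_iff (hc : orient a b c ≠ 0)
    (ha : orient c d a ≠ 0) :
    (openSegment ℝ a b ∩ openSegment ℝ c d).Nonempty ↔
      orient a b c * orient a b d < 0 ∧ orient c d a * orient c d b < 0 :=
  ⟨fun ⟨_, hab, hcd⟩ => ⟨mul_orient_neg_of_mem_openSegment hc hab hcd,
    mul_orient_neg_of_mem_openSegment ha hcd hab⟩,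
    fun ⟨hcd, hab⟩ => openSegment_inter_openSegment_nonempty hcd hab⟩

theorem openSegment_disjoint_of_common_endpoint (h : orient a b c ≠ 0) :
    Disjoint (openSegment ℝ a b) (openSegment ℝ a c) := by
  refine Set.disjoint_left.2 fun p hb hc => ?_
  have hcb : orient a c b ≠ 0 := by rwa [orient_swap_right, neg_ne_zero]
  rw [openSegment_symm] at hb
  simpa [orient, mul_comm] using mul_orient_neg_of_mem_openSegment hcb hc hb

end Orient

section Darts

variable {V M : Type*} [Fintype V] [AddCommMonoid M] (H : SimpleGraph V) [DecidableRel H.Adj]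

theorem sum_dart_eq_sum_ite (f : V → V → M) :
    ∑ d : H.Dart, f d.fst d.snd = ∑ v, ∑ u, if H.Adj v u then f v u else 0 := by
  rw [← Fintype.sum_prod_type', ← Finset.sum_filter]
  exact Finset.sum_bij' (fun d _ => d.toProd) (fun p hp => ⟨p, (Finset.mem_filter.1 hp).2⟩)
    (fun d _ => by simp) (fun p hp => Finset.mem_univ _) (fun d _ => rfl) (fun p hp => rfl)
    (fun d _ => rfl)

theorem sum_dart_fst (f : V → M) : ∑ d : H.Dart, f d.fst = ∑ v, H.degree v • f v := by
  classical
  rw [← Finset.sum_fiberwise (g := fun d : H.Dart => d.fst)]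
  refine Finset.sum_congr rfl fun v _ => ?_
  rw [← H.dart_fst_fiber_card_eq_degree, ← Finset.sum_const]
  exact Finset.sum_congr rfl fun d hd => by rw [(Finset.mem_filter.1 hd).2]

theorem sum_dart_edge [Fintype H.edgeSet] (F : Sym2 V → M) :
    ∑ d : H.Dart, F d.edge = 2 • ∑ e ∈ H.edgeFinset, F e := by
  classical
  rw [← Finset.sum_fiberwise_of_maps_to (g := SimpleGraph.Dart.edge) (t := H.edgeFinset)
    (fun d _ => H.mem_edgeFinset.2 d.edge_mem), Finset.smul_sum]
  refine Finset.sum_congr rfl fun e he => ?_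
  rw [← H.dart_edge_fiber_card e (H.mem_edgeFinset.1 he), ← Finset.sum_const]
  exact Finset.sum_congr rfl fun d hd => by rw [(Finset.mem_filter.1 hd).2]

theorem sum_dart_symm (F : H.Dart → M) : ∑ d : H.Dart, F d.symm = ∑ d, F d :=
  Equiv.sum_comp (Function.Involutive.toPerm _ SimpleGraph.Dart.symm_involutive) F

end Darts

/-- The sum of a function of two darts `(v, u)` and `(w, x)` over the four ways to orient them. -/
def orientationSum {V M : Type*} [Add M] (F : V → V → V → V → M) (v u w x : V) : M :=
  F v u w x + F u v w x + (F v u x w + F u v x w)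

section OrientationSum

variable {V M : Type*} [AddCommMonoid M] (F : V → V → V → V → M)

theorem orientationSum_swap_left (v u w x : V) :
    orientationSum F u v w x = orientationSum F v u w x := by
  simp only [orientationSum, add_comm (F u v _ _)]

theorem orientationSum_swap_right (v u w x : V) :
    orientationSum F v u x w = orientationSum F v u w x :=
  add_comm _ _

theorem sum_dart_orientationSum [Fintype V] (H : SimpleGraph V) [DecidableRel H.Adj] :
    ∑ d : H.Dart, ∑ d' : H.Dart, orientationSum F d.fst d.snd d'.fst d'.snd =
      4 • ∑ d : H.Dart, ∑ d' : H.Dart, F d.fst d.snd d'.fst d'.snd := by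
  have symm_left : ∑ d : H.Dart, ∑ d' : H.Dart, F d.snd d.fst d'.fst d'.snd =
      ∑ d : H.Dart, ∑ d' : H.Dart, F d.fst d.snd d'.fst d'.snd :=
    sum_dart_symm H fun d => ∑ d' : H.Dart, F d.fst d.snd d'.fst d'.snd
  have symm_right (v u : V) : ∑ d' : H.Dart, F v u d'.snd d'.fst =
      ∑ d' : H.Dart, F v u d'.fst d'.snd :=
    sum_dart_symm H fun d' => F v u d'.fst d'.snd
  simp only [orientationSum, Finset.sum_add_distrib, symm_right, symm_left]
  abel

end OrientationSum

theorem sum_dart_commonStart {V : Type*} [Fintype V] [DecidableEq V] (H : SimpleGraph V)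
    [DecidableRel H.Adj] :
    ∑ d : H.Dart, ∑ d' : H.Dart, (if d.fst = d'.fst ∧ d.snd ≠ d'.snd then 1 else 0 : ℤ) =
      ∑ v, (H.degree v : ℤ) * (H.degree v - 1) := by
  have card_eq (d : H.Dart) :
      (∑ d' : H.Dart, if d.fst = d'.fst ∧ d.snd ≠ d'.snd then 1 else 0 : ℤ) =
        H.degree d.fst - 1 := by
    rw [← H.dart_fst_fiber_card_eq_degree, Finset.sum_boole, eq_sub_iff_add_eq]
    norm_cast
    have d_mem : d ∈ ({d' : H.Dart | d'.fst = d.fst} : Finset _) := by simp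
    rw [← Finset.card_erase_add_one d_mem]
    congr 2
    ext d'
    simp only [Finset.mem_filter, Finset.mem_univ, true_and, Finset.mem_erase, ne_eq,
      SimpleGraph.Dart.ext_iff, Prod.ext_iff]
    grind
  simp only [card_eq]
  rw [sum_dart_fst H fun v => (H.degree v : ℤ) - 1]
  simp

theorem sign_sub_sign_mul_sign_sub_sign {a b c d : ℝ} (ha : a ≠ 0) (hb : b ≠ 0) (hc : c ≠ 0)
    (hd : d ≠ 0) (h : a - b = c - d) [Decidable (b * a < 0 ∧ c * d < 0)] :
    ((SignType.sign a : ℤ) - SignType.sign b) * (SignType.sign c - SignType.sign d) =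
      if b * a < 0 ∧ c * d < 0 then 4 else 0 := by
  rcases ha.lt_or_gt with ha | ha <;> rcases hb.lt_or_gt with hb | hb <;>
    rcases hc.lt_or_gt with hc | hc <;> rcases hd.lt_or_gt with hd | hd <;>
    simp [mul_neg_iff, ha, hb, hc, hd, ha.not_gt, hb.not_gt, hc.not_gt, hd.not_gt] <;> linarith

namespace GeometricGraph

variable {n : ℕ} (G : GeometricGraph n) {u v w x : Fin n}

/-- `1` if the vertices `i`, `j`, `k` are in counterclockwise order, `-1` if they are in clockwise
order, and `0` if two of them coincide. -/
noncomputable def orientSign (i j k : Fin n) : ℤ :=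
  SignType.sign (orient (G.point i) (G.point j) (G.point k))

theorem orient_point_ne_zero {i j k : Fin n} (hij : i ≠ j) (hik : i ≠ k) (hjk : j ≠ k) :
    orient (G.point i) (G.point j) (G.point k) ≠ 0 :=
  fun h => G.not_collinear i j k hij hik hjk (collinear_of_orient_eq_zero h)

theorem orientSign_swap_left (i j k : Fin n) : G.orientSign j i k = -G.orientSign i j k := by
  rw [orientSign, orient_swap_left (G.point i), Left.sign_neg, SignType.coe_neg, orientSign]

theorem orientSign_swap_right (i j k : Fin n) : G.orientSign i k j = -G.orientSign i j k := by
  rw [orientSign, orient_swap_right (G.point i), Left.sign_neg, SignType.coe_neg, orientSign]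

@[simp] theorem orientSign_self_left (i k : Fin n) : G.orientSign i i k = 0 := by
  have := G.orientSign_swap_left i i k; lia

@[simp] theorem orientSign_self_right (i k : Fin n) : G.orientSign i k k = 0 := by
  have := G.orientSign_swap_right i k k; lia

@[simp] theorem orientSign_self_outer (i j : Fin n) : G.orientSign i j i = 0 := by
  rw [orientSign_swap_right, orientSign_self_left, neg_zero]

theorem orientSign_mul_self {i j k : Fin n} (hij : i ≠ j) (hik : i ≠ k) (hjk : j ≠ k) :
    G.orientSign i j k * G.orientSign i j k = 1 := by
  rcases (G.orient_point_ne_zero hij hik hjk).lt_or_gt with h | h <;> simp [orientSign, h]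

/-- `1` if `u` and `x` lie on the same side of the line through `v` and `w`, and `-1` if they lie on
opposite sides. The edges in question are `vu` and `wx`. -/
noncomputable def sideProduct (v u w x : Fin n) : ℤ := G.orientSign v w u * G.orientSign v w x

theorem orientationSum_sideProduct (v u w x : Fin n) :
    orientationSum G.sideProduct v u w x =
      (G.orientSign v u x - G.orientSign v u w) * (G.orientSign v w x - G.orientSign u w x) := by
  simp only [orientationSum, sideProduct]
  rw [G.orientSign_swap_right v u w, G.orientSign_swap_right v u x, G.orientSign_swap_right v w x,
    G.orientSign_swap_right u w x, G.orientSign_swap_right u v w, G.orientSign_swap_left v u w,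
    G.orientSign_swap_right u v x, G.orientSign_swap_left v u x]
  ring

/-- The graph on the pairs of vertices in which crossing edges are adjacent. -/
def crossingGraph : SimpleGraph (Sym2 (Fin n)) where
  Adj e f := e ∈ G.graph.edgeSet ∧ f ∈ G.graph.edgeSet ∧ e ≠ f ∧ G.Cross e f
  symm := ⟨fun _ _ ⟨he, hf, hne, hc⟩ => ⟨hf, he, hne.symm, by rwa [Cross, Set.inter_comm]⟩⟩
  loopless := ⟨fun _ h => h.2.2.1 rfl⟩

theorem crossingGraph_adj_iff_cross (hvu : G.graph.Adj v u) (hwx : G.graph.Adj w x) :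
    G.crossingGraph.Adj s(v, u) s(w, x) ↔ s(v, u) ≠ s(w, x) ∧
      (openSegment ℝ (G.point v) (G.point u) ∩ openSegment ℝ (G.point w) (G.point x)).Nonempty :=
  ⟨fun h => h.2.2, fun h => ⟨hvu, hwx, h⟩⟩

theorem not_crossingGraph_adj_of_common (v u x : Fin n) :
    ¬ G.crossingGraph.Adj s(v, u) s(v, x) := by
  rintro ⟨hvu : G.graph.Adj v u, hvx : G.graph.Adj v x, hne, hc⟩
  have hux : u ≠ x := fun h => hne (by rw [h])
  exact hc.not_disjoint <|
    openSegment_disjoint_of_common_endpoint (G.orient_point_ne_zero hvu.ne hvx.ne hux)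

open Classical in
theorem orientationSum_sideProduct_of_distinct (hvu : G.graph.Adj v u) (hwx : G.graph.Adj w x)
    (hvw : v ≠ w) (hvx : v ≠ x) (huw : u ≠ w) (hux : u ≠ x) :
    orientationSum G.sideProduct v u w x =
      if G.crossingGraph.Adj s(v, u) s(w, x) then 4 else 0 := by
  have orient_rotate (p q r) : orient q r p = orient p q r := by simp only [orient]; ring
  have hvuw := G.orient_point_ne_zero hvu.ne hvw huw
  have hvwx := G.orient_point_ne_zero hvw hvx hwx.ne
  have sub_eq_sub : orient (G.point v) (G.point u) (G.point x) -
      orient (G.point v) (G.point u) (G.point w) =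
      orient (G.point v) (G.point w) (G.point x) - orient (G.point u) (G.point w) (G.point x) := by
    simp only [orient]; ring
  rw [orientationSum_sideProduct]
  refine (sign_sub_sign_mul_sign_sub_sign (G.orient_point_ne_zero hvu.ne hvx hux) hvuw hvwx
    (G.orient_point_ne_zero huw hux hwx.ne) sub_eq_sub).trans (if_congr ?_ rfl rfl)
  have edge_ne : s(v, u) ≠ s(w, x) := by simp [hvw, hvx]
  rw [G.crossingGraph_adj_iff_cross hvu hwx, and_iff_right edge_ne,
    openSegment_inter_openSegment_nonempty_iff hvuw
      (G.orient_point_ne_zero hwx.ne hvw.symm hvx.symm),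
    orient_rotate (G.point v), orient_rotate (G.point u)]

open Classical in
theorem orientationSum_sideProduct_of_common (hvu : v ≠ u) (hvx : v ≠ x) :
    orientationSum G.sideProduct v u v x = (if u ≠ x then 1 else 0) := by
  rw [orientationSum_sideProduct, G.orientSign_swap_left v u x]
  obtain rfl | hux := eq_or_ne u x
  · simp
  · simp [hux, G.orientSign_mul_self hvu hvx hux]

open Classical in
theorem orientationSum_sideProduct_of_adj (hvu : G.graph.Adj v u) (hwx : G.graph.Adj w x) :
    orientationSum G.sideProduct v u w x =
      (if G.crossingGraph.Adj s(v, u) s(w, x) then 4 else 0) +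
        orientationSum (fun v u w x => if v = w ∧ u ≠ x then 1 else 0) v u w x := by
  have of_common {v u x : Fin n} (hvu : G.graph.Adj v u) (hvx : G.graph.Adj v x) :
      orientationSum G.sideProduct v u v x =
        (if G.crossingGraph.Adj s(v, u) s(v, x) then 4 else 0) +
          orientationSum (fun v u w x => if v = w ∧ u ≠ x then 1 else 0) v u v x := by
    rw [G.orientationSum_sideProduct_of_common hvu.ne hvx.ne,
      if_neg (G.not_crossingGraph_adj_of_common v u x)]
    simp [orientationSum, hvu.ne.symm, hvx.ne]
  by_cases hvw : v = w
  · subst hvw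
    exact of_common hvu hwx
  by_cases hvx : v = x
  · subst hvx
    simpa only [orientationSum_swap_right, Sym2.eq_swap] using of_common hvu hwx.symm
  by_cases huw : u = w
  · subst huw
    simpa only [orientationSum_swap_left, Sym2.eq_swap] using of_common hvu.symm hwx
  by_cases hux : u = x
  · subst hux
    rw [← orientationSum_swap_left, ← orientationSum_swap_right,
      ← orientationSum_swap_left (v := v), ← orientationSum_swap_right (w := w), Sym2.eq_swap,
      Sym2.eq_swap (a := w)]
    exact of_common hvu.symm hwx.symm
  rw [G.orientationSum_sideProduct_of_distinct hvu hwx hvw hvx huw hux]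
  simp [orientationSum, hvw, hvx, huw, hux]

open Classical in
theorem card_edgeFinset_crossingGraph : G.crossingGraph.edgeFinset.card = G.crossings := by
  rw [crossings, ← Set.ncard_coe_finset, SimpleGraph.coe_edgeFinset]
  congr 1
  ext P
  constructor
  · induction P with | _ e f => ?_
    rintro ⟨he, hf, hne, hc⟩
    exact ⟨e, he, f, hf, hne, hc, rfl⟩
  · rintro ⟨e, he, f, hf, hne, hc, rfl⟩
    exact ⟨he, hf, hne, hc⟩

open Classical in
theorem sum_dart_crossingGraph_adj [DecidableRel G.graph.Adj] :
    ∑ d : G.graph.Dart, ∑ d' : G.graph.Dart,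
      (if G.crossingGraph.Adj d.edge d'.edge then 1 else 0) = 8 * G.crossings := by
  have degree_eq (e : Sym2 (Fin n)) :
      ∑ f ∈ G.graph.edgeFinset, (if G.crossingGraph.Adj e f then 1 else 0) =
        G.crossingGraph.degree e := by
    rw [← G.crossingGraph.card_neighborFinset_eq_degree, Finset.sum_boole, Nat.cast_id]
    congr 1
    ext f
    simpa using fun h : G.crossingGraph.Adj e f => h.2.1
  have degree_eq_zero {e : Sym2 (Fin n)} (he : e ∉ G.graph.edgeFinset) :
      G.crossingGraph.degree e = 0 := by
    rw [← degree_eq]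
    exact Finset.sum_eq_zero fun f _ => if_neg fun h => he (G.graph.mem_edgeFinset.2 h.1)
  have sum_dart_eq (d : G.graph.Dart) :
      ∑ d' : G.graph.Dart, (if G.crossingGraph.Adj d.edge d'.edge then 1 else 0) =
        2 • G.crossingGraph.degree d.edge := by
    rw [← degree_eq, ← sum_dart_edge G.graph fun f => if G.crossingGraph.Adj d.edge f then 1 else 0]
  simp only [sum_dart_eq]
  rw [sum_dart_edge G.graph fun e => 2 • G.crossingGraph.degree e, ← Finset.smul_sum,
    Finset.sum_subset (Finset.subset_univ _) fun e _ he => degree_eq_zero he,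
    G.crossingGraph.sum_degrees_eq_twice_card_edges, card_edgeFinset_crossingGraph]
  simp only [smul_eq_mul]
  ring

theorem sum_dart_sideProduct [DecidableRel G.graph.Adj] :
    ∑ d : G.graph.Dart, ∑ d' : G.graph.Dart, G.sideProduct d.fst d.snd d'.fst d'.snd =
      8 * G.crossings + ∑ v, (G.graph.degree v : ℤ) * (G.graph.degree v - 1) := by
  classical
  have sum_ite_four : ∑ d : G.graph.Dart, ∑ d' : G.graph.Dart,
      (if G.crossingGraph.Adj d.edge d'.edge then 4 else 0 : ℤ) = 4 * (8 * G.crossings) := by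
    have h := G.sum_dart_crossingGraph_adj
    zify at h
    rw [← h, Finset.mul_sum]
    simp only [Finset.mul_sum, mul_ite, mul_one, mul_zero]
  have orientationSum_eq (d d' : G.graph.Dart) :
      orientationSum G.sideProduct d.fst d.snd d'.fst d'.snd =
        (if G.crossingGraph.Adj d.edge d'.edge then 4 else 0) + orientationSum
          (fun v u w x => if v = w ∧ u ≠ x then 1 else 0) d.fst d.snd d'.fst d'.snd :=
    G.orientationSum_sideProduct_of_adj d.adj d'.adj
  have h := sum_dart_orientationSum G.sideProduct G.graph
  simp only [orientationSum_eq, Finset.sum_add_distrib, sum_dart_orientationSum,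
    sum_dart_commonStart] at h
  rw [sum_ite_four, nsmul_eq_mul, nsmul_eq_mul] at h
  lia

end GeometricGraph

namespace RealRAM

variable {W : ℕ} {p q : Program} {b : Test} {Q R : ℕ → State → Prop} {s s' s'' : State} {t : ℕ}

/-- The weakest precondition for total correctness: `p` started in `s` halts after some time `t` in
some state `s'` with `Q t s'`. -/
def WP (W : ℕ) (p : Program) (Q : ℕ → State → Prop) (s : State) : Prop :=
  ∃ t s', Runs W p s t s' ∧ Q t s'

theorem WP.mono (h : WP W p Q s) (hQR : ∀ t s', Q t s' → R t s') : WP W p R s :=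
  let ⟨t, s', hr, hq⟩ := h
  ⟨t, s', hr, hQR t s' hq⟩

theorem WP.seq (h : WP W p (fun t s' => WP W q (fun t' => Q (t + t')) s') s) :
    WP W (.seq p q) Q s :=
  let ⟨_, _, hr, _, _, hr', hq⟩ := h
  ⟨_, _, .seq hr hr', hq⟩

theorem WP.ifThenElse (hp : b.Holds s → WP W p (fun t => Q (t + 1)) s)
    (hq : ¬ b.Holds s → WP W q (fun t => Q (t + 1)) s) : WP W (.ifThenElse b p q) Q s := by
  by_cases hb : b.Holds s
  · obtain ⟨t, s', hr, hQ⟩ := hp hb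
    exact ⟨_, _, .ifTrue hb hr, hQ⟩
  · obtain ⟨t, s', hr, hQ⟩ := hq hb
    exact ⟨_, _, .ifFalse hb hr, hQ⟩

/-- The potential `Φ` pays for the time, and hence also guarantees termination. -/
theorem WP.whileDo (I : State → Prop) (Φ : State → ℕ)
    (hbody : ∀ s, I s → b.Holds s → WP W p (fun t s' => I s' ∧ t + 1 + Φ s' ≤ Φ s) s)
    (h0 : I s) : WP W (.whileDo b p) (fun t s' => I s' ∧ ¬ b.Holds s' ∧ t ≤ Φ s + 1) s := by
  induction h : Φ s using Nat.strong_induction_on generalizing s with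
  | _ m ih =>
  by_cases hb : b.Holds s
  · obtain ⟨t, s', hr, hI, ht⟩ := hbody s h0 hb
    obtain ⟨t', s'', hr', hI', hb', ht'⟩ := ih (Φ s') (by lia) hI rfl
    exact ⟨_, _, .whileTrue hb hr hr', hI', hb', by lia⟩
  · exact ⟨_, _, .whileFalse hb, h0, hb, by lia⟩

namespace State

/-- Write the word `v` to register `d`, without the overflow check of `State.setWord`. -/
def putWord (s : State) (d v : ℕ) : State :=
  { s with wreg := Function.update s.wreg d v }

/-- Write the word `v` to entry `k` of array `a`. -/
def storeWord (s : State) (a k v : ℕ) : State :=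
  { s with wmem := Function.update s.wmem a (Function.update (s.wmem a) k v) }

/-- Write the real number `x` to entry `k` of array `a`. -/
def storeReal (s : State) (a k : ℕ) (x : ℝ) : State :=
  { s with rmem := Function.update s.rmem a (Function.update (s.rmem a) k x) }

variable (s : State) (d i a k c v : ℕ) (x : ℝ)

@[simp] theorem putWord_wreg : (s.putWord d v).wreg i = if i = d then v else s.wreg i := by
  simp [putWord, Function.update_apply]

@[simp] theorem putWord_rreg : (s.putWord d v).rreg = s.rreg := rfl

@[simp] theorem putWord_wmem : (s.putWord d v).wmem = s.wmem := rfl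

@[simp] theorem putWord_rmem : (s.putWord d v).rmem = s.rmem := rfl

@[simp] theorem setReal_wreg : (s.setReal d x).wreg = s.wreg := rfl

@[simp] theorem setReal_rreg : (s.setReal d x).rreg i = if i = d then x else s.rreg i := by
  simp [setReal, Function.update_apply]

@[simp] theorem setReal_wmem : (s.setReal d x).wmem = s.wmem := rfl

@[simp] theorem setReal_rmem : (s.setReal d x).rmem = s.rmem := rfl

@[simp] theorem storeWord_wreg : (s.storeWord a k v).wreg = s.wreg := rfl

@[simp] theorem storeWord_wmem :
    (s.storeWord a k v).wmem c = if c = a then Function.update (s.wmem a) k v else s.wmem c := by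
  simp [storeWord, Function.update_apply]

@[simp] theorem storeWord_rreg : (s.storeWord a k v).rreg = s.rreg := rfl

@[simp] theorem storeWord_rmem : (s.storeWord a k v).rmem = s.rmem := rfl

@[simp] theorem storeReal_wreg : (s.storeReal a k x).wreg = s.wreg := rfl

@[simp] theorem storeReal_rreg : (s.storeReal a k x).rreg = s.rreg := rfl

@[simp] theorem storeReal_wmem : (s.storeReal a k x).wmem = s.wmem := rfl

@[simp] theorem storeReal_rmem :
    (s.storeReal a k x).rmem c = if c = a then Function.update (s.rmem a) k x else s.rmem c := by
  simp [storeReal, Function.update_apply]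

end State

/-- The value of a word operation where it is defined; the junk value of a division by zero is
excluded by `WordOp.Defined`. -/
@[simp] def WordOp.val : WordOp → ℕ → ℕ → ℕ
  | .add, x, y => x + y
  | .sub, x, y => x - y
  | .mul, x, y => x * y
  | .div, x, y => x / y

/-- The operation is defined if its second operand is `y`. -/
@[simp] def WordOp.Defined : WordOp → ℕ → Prop
  | .div, y => y ≠ 0
  | _, _ => True

/-- The value of a real operation where it is defined; the junk value of a division by zero is
excluded by `RealOp.Defined`. -/
@[simp] noncomputable def RealOp.val : RealOp → ℝ → ℝ → ℝ
  | .add, x, y => x + y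
  | .sub, x, y => x - y
  | .mul, x, y => x * y
  | .div, x, y => x / y

/-- The operation is defined if its second operand is `y`. -/
@[simp] def RealOp.Defined : RealOp → ℝ → Prop
  | .div, y => y ≠ 0
  | _, _ => True

/-- The effect of an instruction that does not get stuck. -/
@[simp] noncomputable def Instr.effect (s : State) : Instr → State
  | .wconst d k => s.putWord d k
  | .wop op d i j => s.putWord d (op.val (s.wreg i) (s.wreg j))
  | .wload d a i => s.putWord d (s.wmem a (s.wreg i))
  | .wstore a i r => s.storeWord a (s.wreg i) (s.wreg r)
  | .rcast d i => s.setReal d (s.wreg i)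
  | .rop op d i j => s.setReal d (op.val (s.rreg i) (s.rreg j))
  | .rload d a i => s.setReal d (s.rmem a (s.wreg i))
  | .rstore a i r => s.storeReal a (s.wreg i) (s.rreg r)

/-- The condition under which an instruction does not get stuck. -/
@[simp] def Instr.Safe (W : ℕ) (s : State) : Instr → Prop
  | .wconst _ k => k < W
  | .wop op _ i j => op.Defined (s.wreg j) ∧ op.val (s.wreg i) (s.wreg j) < W
  | .wload _ a i => s.wmem a (s.wreg i) < W
  | .rop op _ _ j => op.Defined (s.rreg j)
  | _ => True

theorem Instr.exec_eq_some_iff {c : Instr} :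
    c.exec W s = some s' ↔ c.Safe W s ∧ c.effect s = s' := by
  cases c with
  | wop op d i j =>
    by_cases hj : s.wreg j = 0 <;> cases op <;>
      simp [Instr.exec, WordOp.eval, State.setWord, State.putWord, hj]
  | rop op d i j => cases op <;> simp [Instr.exec, RealOp.eval]
  | _ => simp [Instr.exec, State.setWord, State.putWord, State.storeWord, State.storeReal]

/-- A part of the memory that can be the target of an instruction: a register or an array. -/
inductive Location where
  | wreg (k : ℕ)
  | rreg (k : ℕ)
  | wmem (a : ℕ)
  | rmem (a : ℕ)
deriving DecidableEq

/-- The location that the instruction changes. -/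
def Instr.target : Instr → Location
  | .wconst d _ => .wreg d
  | .wop _ d _ _ => .wreg d
  | .wload d _ _ => .wreg d
  | .wstore a _ _ => .wmem a
  | .rcast d _ => .rreg d
  | .rop _ d _ _ => .rreg d
  | .rload d _ _ => .rreg d
  | .rstore a _ _ => .rmem a

/-- Whether the location is the target of some instruction of the program. This is a Boolean, so
that for concrete programs it is evaluated by `rfl`. -/
def Program.writes (l : Location) : Program → Bool
  | .skip => false
  | .instr c => c.target = l
  | .seq p q => p.writes l || q.writes l
  | .ifThenElse _ p q => p.writes l || q.writes l
  | .whileDo _ p => p.writes l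

/-- `s'` agrees with `s` on all locations that `p` does not write. -/
structure Frame (p : Program) (s s' : State) : Prop where
  wreg : ∀ k, p.writes (.wreg k) = false → s'.wreg k = s.wreg k
  rreg : ∀ k, p.writes (.rreg k) = false → s'.rreg k = s.rreg k
  wmem : ∀ a, p.writes (.wmem a) = false → s'.wmem a = s.wmem a
  rmem : ∀ a, p.writes (.rmem a) = false → s'.rmem a = s.rmem a

theorem Frame.refl (p : Program) (s : State) : Frame p s s :=
  ⟨fun _ _ => rfl, fun _ _ => rfl, fun _ _ => rfl, fun _ _ => rfl⟩

theorem Frame.trans (h : Frame p s s') (h' : Frame p s' s'') : Frame p s s'' where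
  wreg k hk := (h'.wreg k hk).trans (h.wreg k hk)
  rreg k hk := (h'.rreg k hk).trans (h.rreg k hk)
  wmem a ha := (h'.wmem a ha).trans (h.wmem a ha)
  rmem a ha := (h'.rmem a ha).trans (h.rmem a ha)

theorem Frame.weaken (h : Frame p s s') (hpq : ∀ l, q.writes l = false → p.writes l = false) :
    Frame q s s' where
  wreg k hk := h.wreg k (hpq _ hk)
  rreg k hk := h.rreg k (hpq _ hk)
  wmem a ha := h.wmem a (hpq _ ha)
  rmem a ha := h.rmem a (hpq _ ha)

theorem Instr.frame {c : Instr} (h : c.exec W s = some s') : Frame (.instr c) s s' := by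
  obtain ⟨-, rfl⟩ := Instr.exec_eq_some_iff.1 h
  constructor
  · intro k hk; cases c <;> simp_all [Program.writes, Instr.target, eq_comm]
  · intro k hk; cases c <;> simp_all [Program.writes, Instr.target, eq_comm]
  · intro a ha; cases c <;> simp_all [Program.writes, Instr.target, eq_comm]
  · intro a ha; cases c <;> simp_all [Program.writes, Instr.target, eq_comm]

theorem Runs.frame (h : Runs W p s t s') : Frame p s s' := by
  induction h with
  | skip s => exact .refl _ s
  | instr h => exact Instr.frame h
  | seq _ _ ih ih' =>
    exact .trans (ih.weaken (by simp +contextual [Program.writes]))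
      (ih'.weaken (by simp +contextual [Program.writes]))
  | ifTrue _ _ ih => exact ih.weaken (by simp +contextual [Program.writes])
  | ifFalse _ _ ih => exact ih.weaken (by simp +contextual [Program.writes])
  | whileTrue _ _ _ ih ih' => exact .trans (ih.weaken fun _ => id) ih'
  | whileFalse _ => exact .refl _ _

theorem WP.frame (h : WP W p Q s) : WP W p (fun t s' => Q t s' ∧ Frame p s s') s :=
  let ⟨t, s', hr, hq⟩ := h
  ⟨t, s', hr, hq, hr.frame⟩

theorem WP.whileDo_frame (I : State → Prop) (Φ : State → ℕ)
    (hbody : ∀ s', Frame (.whileDo b p) s s' → I s' → b.Holds s' →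
      WP W p (fun t s'' => I s'' ∧ t + 1 + Φ s'' ≤ Φ s') s')
    (h0 : I s) : WP W (.whileDo b p)
      (fun t s' => Frame (.whileDo b p) s s' ∧ I s' ∧ ¬ b.Holds s' ∧ t ≤ Φ s + 1) s := by
  refine (WP.whileDo (fun s' => Frame (.whileDo b p) s s' ∧ I s') Φ ?_ ⟨.refl _ s, h0⟩).mono
    fun t s' h => ⟨h.1.1, h.1.2, h.2⟩
  rintro s' ⟨hf, hI⟩ hb
  exact (hbody s' hf hI hb).frame.mono fun t s'' h =>
    ⟨⟨hf.trans (h.2.weaken fun _ => id), h.1.1⟩, h.1.2⟩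

/-- Straight line code: the instructions of a list, one after the other. -/
def block : List Instr → Program
  | [] => .skip
  | c :: l => .seq (.instr c) (block l)

/-- The effect of straight line code that does not get stuck. -/
@[simp] noncomputable def blockEffect : List Instr → State → State
  | [], s => s
  | c :: l, s => blockEffect l (c.effect s)

/-- The condition under which straight line code does not get stuck. -/
@[simp] def BlockSafe (W : ℕ) : List Instr → State → Prop
  | [], _ => True
  | c :: l, s => c.Safe W s ∧ BlockSafe W l (c.effect s)

theorem WP.block {l : List Instr} (hl : BlockSafe W l s) (h : Q l.length (blockEffect l s)) :
    WP W (block l) Q s := by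
  induction l generalizing s Q with
  | nil => exact ⟨0, s, .skip s, h⟩
  | cons c l ih =>
    refine .seq ⟨1, _, .instr (Instr.exec_eq_some_iff.2 ⟨hl.1, rfl⟩), ih hl.2 ?_⟩
    rwa [add_comm]

/-- `for i := i, …, m - 1 do p`, where word register `one` holds `1`. -/
def forLoop (i m one : ℕ) (p : Program) : Program :=
  .whileDo (.wlt i m) (.seq p (block [.wop .add i i one]))

theorem forLoop_writes_wreg {i m one k : ℕ} (hk : k ≠ i) (hp : p.writes (.wreg k) = false) :
    (forLoop i m one p).writes (.wreg k) = false := by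
  simp [forLoop, Program.writes, hp, block, Instr.target, hk.symm]

/-- `C` bounds the time of one execution of the body. -/
theorem WP.forLoop {i m one N C : ℕ} (I : ℕ → State → Prop)
    (hi : s.wreg i = 0) (hm : s.wreg m = N) (hone : s.wreg one = 1)
    (hpi : p.writes (.wreg i) = false) (hpm : p.writes (.wreg m) = false)
    (hpone : p.writes (.wreg one) = false) (him : i ≠ m) (hio : i ≠ one) (hN : N < W) (h0 : I 0 s)
    (hbody : ∀ k s', k < N → Frame (forLoop i m one p) s s' → s'.wreg i = k → I k s' →
      WP W p (fun t s'' => t ≤ C ∧ I (k + 1) (s''.putWord i (k + 1))) s') :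
    WP W (forLoop i m one p)
      (fun t s' => Frame (forLoop i m one p) s s' ∧ I N s' ∧ s'.wreg i = N ∧ t ≤ N * (C + 2) + 1)
      s := by
  have hm' {s'} (hf : Frame (RealRAM.forLoop i m one p) s s') : s'.wreg m = N :=
    (hf.wreg m (forLoop_writes_wreg him.symm hpm)).trans hm
  refine (WP.whileDo_frame (fun s' => s'.wreg i ≤ N ∧ I (s'.wreg i) s')
    (fun s' => (N - s'.wreg i) * (C + 2)) ?_ ⟨hi ▸ N.zero_le, by rwa [hi]⟩).mono ?_
  · intro s' hf ⟨_, hI⟩ hb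
    have hlt : s'.wreg i < N := hm' hf ▸ hb
    refine .seq ((hbody _ s' hlt hf rfl hI).frame.mono fun t s'' ⟨⟨ht, hI'⟩, hf'⟩ => ?_)
    have hi' : s''.wreg i = s'.wreg i := hf'.wreg i hpi
    have hone' : s''.wreg one = 1 := (hf'.wreg one hpone).trans <|
      (hf.wreg one (forLoop_writes_wreg hio.symm hpone)).trans hone
    refine .block ?_ ?_
    · simp only [BlockSafe, Instr.Safe, WordOp.Defined, WordOp.val, hi', hone', true_and, and_true]
      lia
    · simp only [blockEffect, Instr.effect, WordOp.val, hi', hone', State.putWord_wreg, if_true,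
        List.length]
      refine ⟨⟨hlt, hI'⟩, ?_⟩
      obtain ⟨r, rfl⟩ := Nat.exists_eq_add_of_lt hlt
      rw [show s'.wreg i + r + 1 - (s'.wreg i + 1) = r by lia,
        show s'.wreg i + r + 1 - s'.wreg i = r + 1 by lia]
      nlinarith [ht]
  · intro t s' ⟨hf, ⟨hle, hI⟩, hb, ht⟩
    have hiN : s'.wreg i = N := hle.antisymm (not_lt.1 (hm' hf ▸ hb))
    exact ⟨hf, hiN ▸ hI, hiN, by rwa [hi, Nat.sub_zero] at ht⟩

end RealRAM

section slice

variable {α β ι : Type*} {f g : ℕ → α} {a b c m n w : ℕ} {κ : ι → β} {A B : ℕ → ι}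

/-- The values of `f` on `[a, b)`, in order. -/
def slice (f : ℕ → α) (a b : ℕ) : List α := (List.range' a (b - a)).map f

theorem length_slice (f : ℕ → α) (a b : ℕ) : (slice f a b).length = b - a := by simp [slice]

theorem slice_of_le (f : ℕ → α) (h : b ≤ a) : slice f a b = [] := by
  simp [slice, Nat.sub_eq_zero_of_le h]

theorem slice_of_lt (f : ℕ → α) (h : a < b) : slice f a b = f a :: slice f (a + 1) b := by
  rw [slice, show b - a = (b - (a + 1)) + 1 by lia, List.range'_succ]
  rfl

theorem slice_append_slice (f : ℕ → α) (hab : a ≤ b) (hbc : b ≤ c) :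
    slice f a b ++ slice f b c = slice f a c := by
  obtain ⟨d, rfl⟩ := Nat.exists_eq_add_of_le hab
  obtain ⟨e, rfl⟩ := Nat.exists_eq_add_of_le hbc
  simp only [slice, ← List.map_append]
  rw [show a + d + e - a = d + e by lia, ← List.range'_append_1]
  simp

theorem slice_succ (f : ℕ → α) (h : a ≤ b) : slice f a (b + 1) = slice f a b ++ [f b] := by
  rw [← slice_append_slice f h b.le_succ, slice_of_lt f b.lt_succ_self, slice_of_le f le_rfl]

theorem slice_congr (h : ∀ k, a ≤ k → k < b → f k = g k) : slice f a b = slice g a b :=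
  List.map_congr_left fun k hk => by
    rw [List.mem_range'_1] at hk
    exact h k hk.1 (by lia)

theorem slice_update_succ (f : ℕ → α) (h : a ≤ b) (x : α) :
    slice (Function.update f b x) a (b + 1) = slice f a b ++ [x] := by
  rw [slice_succ _ h, Function.update_self,
    slice_congr fun k _ hk => Function.update_of_ne hk.ne x f]

theorem mem_slice {x : α} : x ∈ slice f a b ↔ ∃ k, a ≤ k ∧ k < b ∧ f k = x := by
  simp only [slice, List.mem_map, List.mem_range'_1, and_assoc]
  exact exists_congr fun k => and_congr_right fun h => by rw [show k < a + (b - a) ↔ k < b by lia]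

theorem pairwise_slice {r : α → α → Prop} :
    (slice f a b).Pairwise r ↔ ∀ p q, a ≤ p → p < q → q < b → r (f p) (f q) := by
  rw [slice, List.pairwise_map, List.pairwise_iff_getElem]
  simp only [List.length_range', List.getElem_range', one_mul]
  refine ⟨fun h p q hap hpq hqb => ?_, fun h i j _ _ _ => h _ _ (by lia) (by lia) (by lia)⟩
  have := h (p - a) (q - a) (by lia) (by lia) (by lia)
  rwa [Nat.add_sub_cancel' hap, Nat.add_sub_cancel' (hap.trans hpq.le)] at this

theorem lt_of_slice_perm_range {f : ℕ → ℕ} {k : ℕ} (h : (slice f 0 n).Perm (List.range n))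
    (hk : k < n) : f k < n :=
  List.mem_range.1 (h.subset (mem_slice.2 ⟨k, k.zero_le, hk, rfl⟩))

variable [LinearOrder β]

/-- Comparison of indices by their keys, in the form that `List.merge` expects. -/
def keyLE (κ : ι → β) (i j : ι) : Bool := decide (κ i ≤ κ j)

theorem pairwise_merge_keyLE {l l' : List ι} (hl : l.Pairwise fun i j => κ i ≤ κ j)
    (hl' : l'.Pairwise fun i j => κ i ≤ κ j) :
    (l.merge l' (keyLE κ)).Pairwise fun i j => κ i ≤ κ j := by
  simpa [keyLE] using List.pairwise_merge (le := keyLE κ)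
    (by simpa [keyLE] using fun _ _ _ => le_trans) (by simpa [keyLE] using fun _ _ => le_total _ _)
    l l' (by simpa [keyLE]) (by simpa [keyLE])

/-- On each block `[b * w, (b + 1) * w)`, cut off at `n`, the values of `f` are sorted by their
keys: the invariant of bottom-up merge sort. -/
def BlockSorted (κ : ι → β) (w n : ℕ) (f : ℕ → ι) : Prop :=
  ∀ p q, p < q → q < n → p / w = q / w → κ (f p) ≤ κ (f q)

theorem BlockSorted.one : BlockSorted κ 1 n A := fun p q hpq _ h => by
  simp only [Nat.div_one] at h
  exact absurd h hpq.ne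

theorem BlockSorted.le (h : BlockSorted κ w n A) (hn : n ≤ w) {p q : ℕ} (hpq : p < q)
    (hq : q < n) : κ (A p) ≤ κ (A q) :=
  h p q hpq hq (by rw [Nat.div_eq_of_lt (by lia), Nat.div_eq_of_lt (by lia)])

theorem BlockSorted.congr (h : BlockSorted κ w n A) (hAB : ∀ k < n, B k = A k) :
    BlockSorted κ w n B := fun p q hpq hq hd => by
  rw [hAB p (hpq.trans hq), hAB q hq]
  exact h p q hpq hq hd

theorem BlockSorted.pairwise_slice (h : BlockSorted κ w n A) (ha : b * w ≤ a) (hc : c ≤ (b + 1) * w)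
    (hcn : c ≤ n) : (slice A a c).Pairwise fun i j => κ i ≤ κ j :=
  _root_.pairwise_slice.2 fun p q hap hpq hqc => h p q hpq (by lia) <| by
    rw [Nat.div_eq_of_lt_le (ha.trans hap) (by lia),
      Nat.div_eq_of_lt_le (ha.trans (hap.trans hpq.le)) (by lia)]

theorem BlockSorted.append (h : BlockSorted κ w (b * w) A)
    (hs : (slice A (b * w) m).Pairwise fun i j => κ i ≤ κ j) (hm : m ≤ (b + 1) * w) :
    BlockSorted κ w m A := by
  intro p q hpq hq hd
  rcases lt_or_ge q (b * w) with hqb | hqb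
  · exact h p q hpq hqb hd
  · rw [Nat.div_eq_of_lt_le hqb (by lia)] at hd
    exact _root_.pairwise_slice.1 hs p q (hd ▸ Nat.div_mul_le_self p w) hpq hq

theorem BlockSorted.merge (hA : BlockSorted κ w n A) (hB : BlockSorted κ (2 * w) (b * (2 * w)) B)
    (h : slice B (b * (2 * w)) (min (b * (2 * w) + 2 * w) n) =
      (slice A (b * (2 * w)) (min (b * (2 * w) + w) n)).merge
        (slice A (min (b * (2 * w) + w) n) (min (b * (2 * w) + 2 * w) n)) (keyLE κ)) :
    BlockSorted κ (2 * w) (min (b * (2 * w) + 2 * w) n) B := by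
  refine hB.append (h ▸ pairwise_merge_keyLE ?_ ?_) (by lia)
  · exact hA.pairwise_slice (b := 2 * b) (by lia) (by lia) (by lia)
  · rcases le_total (b * (2 * w) + w) n with hn | hn
    · exact hA.pairwise_slice (b := 2 * b + 1) (by lia) (by lia) (by lia)
    · rw [slice_of_le _ (by lia)]
      exact .nil

end slice

namespace RealRAM

/-! Merge sort. -/

namespace WordReg

@[simp] abbrev size : ℕ := 0
@[simp] abbrev one : ℕ := 1
@[simp] abbrev width : ℕ := 2
@[simp] abbrev lo : ℕ := 3
@[simp] abbrev mid : ℕ := 4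
@[simp] abbrev hi : ℕ := 5
@[simp] abbrev left : ℕ := 6
@[simp] abbrev right : ℕ := 7
@[simp] abbrev out : ℕ := 8
@[simp] abbrev entry : ℕ := 9
@[simp] abbrev entry' : ℕ := 10

end WordReg

namespace RealReg

@[simp] abbrev key : ℕ := 0
@[simp] abbrev key' : ℕ := 1

end RealReg

namespace WordArray

@[simp] abbrev list : ℕ := 1
@[simp] abbrev buffer : ℕ := 2

end WordArray

namespace RealArray

@[simp] abbrev keys : ℕ := 2

end RealArray

/-- Copy a word register; there is no instruction for this, but register `one` holds `1`. -/
@[simp] def copyReg (d i : ℕ) : Instr := .wop .mul d i WordReg.one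

/-- Move the list entry whose index is in register `i` to the end of the buffer. -/
def takeEntry (i : ℕ) : Program :=
  block [.wload WordReg.entry WordArray.list i, .wstore WordArray.buffer WordReg.out WordReg.entry,
    .wop .add i i WordReg.one, .wop .add WordReg.out WordReg.out WordReg.one]

/-- Take the entry with the smaller key of the two whose indices are in `left` and `right`. -/
def takeSmaller : Program :=
  .seq
    (block [.wload WordReg.entry WordArray.list WordReg.left,
      .wload WordReg.entry' WordArray.list WordReg.right,
      .rload RealReg.key RealArray.keys WordReg.entry,
      .rload RealReg.key' RealArray.keys WordReg.entry'])
    (.ifThenElse (.rlt RealReg.key' RealReg.key)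
      (takeEntry WordReg.right) (takeEntry WordReg.left))

/-- One step of the merge of the two blocks of the list that start at the indices in the registers
`left` and `right` and end before the indices in `mid` and `hi`. -/
def mergeStep : Program :=
  .ifThenElse (.wlt WordReg.left WordReg.mid)
    (.ifThenElse (.wlt WordReg.right WordReg.hi) takeSmaller (takeEntry WordReg.left))
    (takeEntry WordReg.right)

/-- Merge the two blocks, until the buffer is filled up to the index in register `hi`. -/
def mergeLoop : Program := .whileDo (.wlt WordReg.out WordReg.hi) mergeStep

variable {W n w lo : ℕ} {s s' : State} {x : ℕ} {l : List ℕ}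

/-- The list that `mergeLoop` still has to write to the buffer. -/
noncomputable def remainingMerge (s : State) : List ℕ :=
  (slice (s.wmem WordArray.list) (s.wreg WordReg.left) (s.wreg WordReg.mid)).merge
    (slice (s.wmem WordArray.list) (s.wreg WordReg.right) (s.wreg WordReg.hi))
    (keyLE (s.rmem RealArray.keys))

/-- From `s` to `s'`, the entry `x` has been moved to the end of the buffer, and `l` is what then
remains to be merged. -/
structure MovesEntry (s s' : State) (x : ℕ) (l : List ℕ) : Prop where
  remaining : remainingMerge s' = l
  out : s'.wreg WordReg.out = s.wreg WordReg.out + 1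
  buffer : s'.wmem WordArray.buffer =
    Function.update (s.wmem WordArray.buffer) (s.wreg WordReg.out) x

theorem takeEntry_left_spec (hone : s.wreg WordReg.one = 1)
    (hlt : s.wreg WordReg.left < s.wreg WordReg.mid) (hmid : s.wreg WordReg.mid < W)
    (hout : s.wreg WordReg.out + 1 < W)
    (hx : s.wmem WordArray.list (s.wreg WordReg.left) = x) (hxW : x < W)
    (hl : (slice (s.wmem WordArray.list) (s.wreg WordReg.left + 1) (s.wreg WordReg.mid)).merge
      (slice (s.wmem WordArray.list) (s.wreg WordReg.right) (s.wreg WordReg.hi))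
      (keyLE (s.rmem RealArray.keys)) = l) :
    WP W (takeEntry WordReg.left) (fun t s' => t = 4 ∧ MovesEntry s s' x l) s := by
  subst x l
  refine .block ?_ ⟨rfl, ?_, ?_, ?_⟩
  · simp_all
    lia
  · simp [hone, remainingMerge]
  · simp [hone]
  · simp

theorem takeEntry_right_spec (hone : s.wreg WordReg.one = 1)
    (hlt : s.wreg WordReg.right < s.wreg WordReg.hi) (hhi : s.wreg WordReg.hi < W)
    (hout : s.wreg WordReg.out + 1 < W)
    (hx : s.wmem WordArray.list (s.wreg WordReg.right) = x) (hxW : x < W)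
    (hl : (slice (s.wmem WordArray.list) (s.wreg WordReg.left) (s.wreg WordReg.mid)).merge
      (slice (s.wmem WordArray.list) (s.wreg WordReg.right + 1) (s.wreg WordReg.hi))
      (keyLE (s.rmem RealArray.keys)) = l) :
    WP W (takeEntry WordReg.right) (fun t s' => t = 4 ∧ MovesEntry s s' x l) s := by
  subst x l
  refine .block ?_ ⟨rfl, ?_, ?_, ?_⟩
  · simp_all
    lia
  · simp [hone, remainingMerge]
  · simp [hone]
  · simp

theorem takeSmaller_spec (hone : s.wreg WordReg.one = 1)
    (hl : s.wreg WordReg.left < s.wreg WordReg.mid) (hr : s.wreg WordReg.right < s.wreg WordReg.hi)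
    (hmid : s.wreg WordReg.mid < W) (hhi : s.wreg WordReg.hi < W)
    (hout : s.wreg WordReg.out + 1 < W) (hx : remainingMerge s = x :: l)
    (hW : ∀ y ∈ x :: l, y < W) :
    WP W takeSmaller (fun t s' => t ≤ 9 ∧ MovesEntry s s' x l) s := by
  rw [remainingMerge, slice_of_lt _ hl, slice_of_lt _ hr] at hx
  have hlW : s.wmem WordArray.list (s.wreg WordReg.left) < W :=
    hW _ (hx ▸ List.mem_merge.2 (.inl List.mem_cons_self))
  have hrW : s.wmem WordArray.list (s.wreg WordReg.right) < W :=
    hW _ (hx ▸ List.mem_merge.2 (.inr List.mem_cons_self))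
  rw [List.cons_merge_cons, ← slice_of_lt _ hl, ← slice_of_lt _ hr] at hx
  refine .seq (.block (by simp [hlW, hrW]) (.ifThenElse (fun hc => ?_) fun hc => ?_))
  · have hlt : s.rmem RealArray.keys (s.wmem WordArray.list (s.wreg WordReg.right)) <
        s.rmem RealArray.keys (s.wmem WordArray.list (s.wreg WordReg.left)) := by
      simpa [Test.Holds] using hc
    rw [if_neg (by simpa [keyLE] using hlt), List.cons.injEq] at hx
    obtain ⟨rfl, rfl⟩ := hx
    exact (takeEntry_right_spec (by simpa) (by simpa) (by simpa) (by simpa) (by simp) hrW rfl).mono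
      fun t s' ⟨ht, hm⟩ => ⟨by simp [ht], hm.1, by simpa using hm.2, by simpa using hm.3⟩
  · have hle : s.rmem RealArray.keys (s.wmem WordArray.list (s.wreg WordReg.left)) ≤
        s.rmem RealArray.keys (s.wmem WordArray.list (s.wreg WordReg.right)) := by
      simpa [Test.Holds] using hc
    rw [if_pos (by simpa [keyLE] using hle), List.cons.injEq] at hx
    obtain ⟨rfl, rfl⟩ := hx
    exact (takeEntry_left_spec (by simpa) (by simpa) (by simpa) (by simpa) (by simp) hlW rfl).mono
      fun t s' ⟨ht, hm⟩ => ⟨by simp [ht], hm.1, by simpa using hm.2, by simpa using hm.3⟩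

theorem mergeStep_spec (hone : s.wreg WordReg.one = 1) (hmid : s.wreg WordReg.mid < W)
    (hhi : s.wreg WordReg.hi < W) (hout : s.wreg WordReg.out + 1 < W)
    (hx : remainingMerge s = x :: l) (hW : ∀ y ∈ x :: l, y < W) :
    WP W mergeStep (fun t s' => t ≤ 11 ∧ MovesEntry s s' x l) s := by
  refine .ifThenElse (fun hl => .ifThenElse (fun hr => ?_) fun hr => ?_) fun hl => ?_
  · exact (takeSmaller_spec hone hl hr hmid hhi hout hx hW).mono fun t s' h => ⟨by lia, h.2⟩
  · simp only [Test.Holds, not_lt] at hr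
    rw [remainingMerge, slice_of_lt _ hl, slice_of_le _ hr, List.merge_right] at hx
    obtain ⟨rfl, rfl⟩ := List.cons.inj hx
    exact (takeEntry_left_spec hone hl hmid hout rfl (hW _ List.mem_cons_self)
      (by rw [slice_of_le _ hr, List.merge_right])).mono fun t s' h => ⟨by lia, h.2⟩
  · simp only [Test.Holds, not_lt] at hl
    have hr : s.wreg WordReg.right < s.wreg WordReg.hi := by
      by_contra! hr
      simp [remainingMerge, slice_of_le _ hl, slice_of_le _ hr] at hx
    rw [remainingMerge, slice_of_le _ hl, slice_of_lt _ hr, List.nil_merge] at hx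
    obtain ⟨rfl, rfl⟩ := List.cons.inj hx
    exact (takeEntry_right_spec hone hr hhi hout rfl (hW _ List.mem_cons_self)
      (by rw [slice_of_le _ hl, List.nil_merge])).mono fun t s' h => ⟨by lia, h.2⟩

theorem mergeLoop_spec (hone : s.wreg WordReg.one = 1) (hmid : s.wreg WordReg.mid < W)
    (hhi : s.wreg WordReg.hi < W)
    (hlen : s.wreg WordReg.out + (remainingMerge s).length = s.wreg WordReg.hi)
    (hW : ∀ y ∈ remainingMerge s, y < W) :
    WP W mergeLoop (fun t s' => t ≤ (remainingMerge s).length * 12 + 1 ∧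
      slice (s'.wmem WordArray.buffer) (s.wreg WordReg.out) (s.wreg WordReg.hi) =
        remainingMerge s ∧
      ∀ k < s.wreg WordReg.out, s'.wmem WordArray.buffer k = s.wmem WordArray.buffer k) s := by
  refine (WP.whileDo_frame (fun s' => s.wreg WordReg.out ≤ s'.wreg WordReg.out ∧
    s'.wreg WordReg.out + (remainingMerge s').length = s.wreg WordReg.hi ∧
    slice (s'.wmem WordArray.buffer) (s.wreg WordReg.out) (s'.wreg WordReg.out) ++
      remainingMerge s' = remainingMerge s ∧
    ∀ k < s.wreg WordReg.out, s'.wmem WordArray.buffer k = s.wmem WordArray.buffer k)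
    (fun s' => (remainingMerge s').length * 12) ?_
    ⟨le_rfl, hlen, by rw [slice_of_le _ le_rfl, List.nil_append], fun _ _ => rfl⟩).mono ?_
  · rintro s' hf ⟨hle, hlen', hM, hpre⟩ hb
    have hhi' : s'.wreg WordReg.hi = s.wreg WordReg.hi := hf.wreg _ rfl
    have hlt : s'.wreg WordReg.out < s.wreg WordReg.hi := hhi' ▸ hb
    obtain ⟨x, l, hx⟩ := List.exists_cons_of_length_pos
      (show 0 < (remainingMerge s').length by lia)
    rw [hx] at hlen' hM
    rw [hx, List.length_cons]
    refine (mergeStep_spec ((hf.wreg _ rfl).trans hone) (by rwa [hf.wreg WordReg.mid rfl])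
      (by rwa [hhi']) (by lia) hx fun y hy => hW y (hM ▸ List.mem_append_right _ hy)).mono ?_
    rintro t s'' ⟨ht, hm⟩
    rw [hm.remaining, hm.out, hm.buffer, slice_update_succ _ hle]
    refine ⟨⟨by lia, by rw [List.length_cons] at hlen'; lia, by simpa using hM, fun k hk => ?_⟩,
      by lia⟩
    rw [Function.update_of_ne (by lia), hpre k hk]
  · rintro t s' ⟨hf, ⟨-, hlen', hM, hpre⟩, hb, ht⟩
    have hhi' : s'.wreg WordReg.hi = s.wreg WordReg.hi := hf.wreg _ rfl
    simp only [Test.Holds, hhi', not_lt] at hb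
    have hnil : remainingMerge s' = [] := List.eq_nil_of_length_eq_zero (by lia)
    have hout : s'.wreg WordReg.out = s.wreg WordReg.hi := by simpa [hnil] using hlen'
    exact ⟨ht, by simpa [hnil, hout] using hM, hpre⟩

/-- Merge the blocks `[lo, lo + width)` and `[lo + width, lo + 2 * width)`, cut off at `size`, and
advance `lo`. The minimum of `size` and `k` is computed as `size - (size - k)`. -/
def mergeBlocks : Program :=
  .seq
    (block [
      .wop .add WordReg.mid WordReg.lo WordReg.width,
      .wop .sub WordReg.mid WordReg.size WordReg.mid,
      .wop .sub WordReg.mid WordReg.size WordReg.mid,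
      .wop .add WordReg.hi WordReg.mid WordReg.width,
      .wop .sub WordReg.hi WordReg.size WordReg.hi,
      .wop .sub WordReg.hi WordReg.size WordReg.hi,
      copyReg WordReg.left WordReg.lo,
      copyReg WordReg.right WordReg.mid,
      copyReg WordReg.out WordReg.lo])
    (.seq mergeLoop (block [copyReg WordReg.lo WordReg.hi]))

theorem mergeBlocks_spec (hsize : s.wreg WordReg.size = n) (hone : s.wreg WordReg.one = 1)
    (hwidth : s.wreg WordReg.width = w) (hlo : s.wreg WordReg.lo = lo) (hlon : lo < n) (hw : w < n)
    (hW : 2 * n < W) (hlist : ∀ k < n, s.wmem WordArray.list k < W) :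
    WP W mergeBlocks (fun t s' => t ≤ (min (lo + 2 * w) n - lo) * 12 + 11 ∧
      s'.wreg WordReg.lo = min (lo + 2 * w) n ∧
      slice (s'.wmem WordArray.buffer) lo (min (lo + 2 * w) n) =
        (slice (s.wmem WordArray.list) lo (min (lo + w) n)).merge
          (slice (s.wmem WordArray.list) (min (lo + w) n) (min (lo + 2 * w) n))
          (keyLE (s.rmem RealArray.keys)) ∧
      ∀ k < lo, s'.wmem WordArray.buffer k = s.wmem WordArray.buffer k) s := by
  have hmid : n - (n - (lo + w)) = min (lo + w) n := by lia
  have hhi : n - (n - (min (lo + w) n + w)) = min (lo + 2 * w) n := by lia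
  refine .seq (.block (by simp [hsize, hone, hwidth, hlo, hmid, hhi]; lia) (.seq ?_))
  generalize hs₁ : blockEffect _ s = s₁
  have hlo₁ : s₁.wreg WordReg.out = lo := by simp [← hs₁, hlo, hone]
  have hmid₁ : s₁.wreg WordReg.mid = min (lo + w) n := by simp [← hs₁, hsize, hwidth, hlo, hmid]
  have hhi₁ : s₁.wreg WordReg.hi = min (lo + 2 * w) n := by
    simp [← hs₁, hsize, hwidth, hlo, hmid, hhi]
  have hone₁ : s₁.wreg WordReg.one = 1 := by simp [← hs₁, hone]
  have hbuf₁ : s₁.wmem WordArray.buffer = s.wmem WordArray.buffer := by simp [← hs₁]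
  have hM : remainingMerge s₁ = (slice (s.wmem WordArray.list) lo (min (lo + w) n)).merge
      (slice (s.wmem WordArray.list) (min (lo + w) n) (min (lo + 2 * w) n))
      (keyLE (s.rmem RealArray.keys)) := by
    simp [← hs₁, remainingMerge, hsize, hwidth, hlo, hone, hmid, hhi]
  have hlen : (remainingMerge s₁).length = min (lo + 2 * w) n - lo := by
    rw [hM, List.length_merge, length_slice, length_slice]
    lia
  refine (mergeLoop_spec hone₁ (by lia) (by lia) (by lia) fun y hy => ?_).frame.mono ?_
  · simp only [hM, List.mem_merge, mem_slice] at hy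
    obtain ⟨k, -, hk, rfl⟩ | ⟨k, -, hk, rfl⟩ := hy <;> exact hlist k (by lia)
  · rw [hlo₁, hhi₁, hlen, hM, hbuf₁]
    rintro t s' ⟨⟨ht, hs, hpre⟩, hf⟩
    have hhi' : s'.wreg WordReg.hi = min (lo + 2 * w) n := (hf.wreg _ rfl).trans hhi₁
    have hone' : s'.wreg WordReg.one = 1 := (hf.wreg _ rfl).trans hone₁
    refine .block (by simp [hhi', hone']; lia) ⟨?_, by simp [hhi', hone'], hs, hpre⟩
    simp only [List.length]
    lia

/-- Merge the blocks of length `width` of the list in pairs, into the buffer. -/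
def mergeAllBlocks : Program :=
  .seq (block [.wconst WordReg.lo 0]) (.whileDo (.wlt WordReg.lo WordReg.size) mergeBlocks)

/-- Copy the buffer back to the list. -/
def copyBack : Program :=
  .seq (block [.wconst WordReg.lo 0])
    (forLoop WordReg.lo WordReg.size WordReg.one
      (block [.wload WordReg.entry WordArray.buffer WordReg.lo,
        .wstore WordArray.list WordReg.lo WordReg.entry]))

/-- One pass of merge sort, which doubles the width of the sorted blocks. -/
def mergePass : Program :=
  .seq mergeAllBlocks (.seq copyBack (block [.wop .add WordReg.width WordReg.width WordReg.width]))

/-- Bottom-up merge sort of the list by the keys of its entries. -/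
def mergeSort : Program :=
  .seq (block [.wconst WordReg.width 1])
    (.whileDo (.wlt WordReg.width WordReg.size) mergePass)

theorem mergeAllBlocks_spec (hsize : s.wreg WordReg.size = n) (hone : s.wreg WordReg.one = 1)
    (hwidth : s.wreg WordReg.width = w) (hw₀ : 0 < w) (hw : w < n)
    (hW : 2 * n < W)
    (hlist : ∀ k < n, s.wmem WordArray.list k < W)
    (hsort : BlockSorted (s.rmem RealArray.keys) w n (s.wmem WordArray.list)) :
    WP W mergeAllBlocks (fun t s' => t ≤ n * 24 + 2 ∧
      (slice (s'.wmem WordArray.buffer) 0 n).Perm (slice (s.wmem WordArray.list) 0 n) ∧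
      BlockSorted (s.rmem RealArray.keys) (2 * w) n (s'.wmem WordArray.buffer)) s := by
  refine .seq (.block (by simp; lia) ?_)
  refine (WP.whileDo_frame (fun s' => ∃ b, s'.wreg WordReg.lo = min (b * (2 * w)) n ∧
    (slice (s'.wmem WordArray.buffer) 0 (s'.wreg WordReg.lo)).Perm
      (slice (s.wmem WordArray.list) 0 (s'.wreg WordReg.lo)) ∧
    BlockSorted (s.rmem RealArray.keys) (2 * w) (s'.wreg WordReg.lo) (s'.wmem WordArray.buffer))
    (fun s' => (n - s'.wreg WordReg.lo) * 24) ?_ ?_).mono ?_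
  · rintro s' hf ⟨b, hlo, hp, hs⟩ hb
    have hsize' : s'.wreg WordReg.size = n := (hf.wreg _ rfl).trans hsize
    have hlist' : s'.wmem WordArray.list = s.wmem WordArray.list := hf.wmem _ rfl
    have hlon : s'.wreg WordReg.lo < n := hsize' ▸ hb
    replace hlo : s'.wreg WordReg.lo = b * (2 * w) := by lia
    rw [hlo] at hlon hp hs
    refine (mergeBlocks_spec hsize' ((hf.wreg _ rfl).trans hone) ((hf.wreg _ rfl).trans hwidth)
      hlo hlon hw hW (by rwa [hlist'])).mono ?_
    rintro t s'' ⟨ht, hlo', hm, hpre⟩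
    rw [hlist', hf.rmem RealArray.keys rfl] at hm
    rw [hlo']
    refine ⟨⟨b + 1, by lia, ?_, ?_⟩, by lia⟩
    · rw [← slice_append_slice _ (Nat.zero_le _) (show b * (2 * w) ≤ _ by lia),
        slice_congr fun k _ hk => hpre k hk, hm,
        ← slice_append_slice (s.wmem _) (Nat.zero_le _) (show b * (2 * w) ≤ _ by lia),
        ← slice_append_slice (s.wmem _) (show b * (2 * w) ≤ min (b * (2 * w) + w) n by lia)
          (show _ ≤ min (b * (2 * w) + 2 * w) n by lia)]
      exact hp.append (List.merge_perm_append _)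
    · exact hsort.merge (hs.congr hpre) hm
  · exact ⟨0, by simp, by simp [slice_of_le], fun p q _ hq => by simp at hq⟩
  · rintro t s' ⟨hf, ⟨b, hlo, hp, hs⟩, hb, ht⟩
    have hsize' : s'.wreg WordReg.size = n := (hf.wreg _ rfl).trans hsize
    simp only [Test.Holds, hsize', not_lt] at hb
    rw [show s'.wreg WordReg.lo = n by lia] at hp hs
    exact ⟨by simp at ht ⊢; lia, hp, hs⟩

theorem copyBack_spec (hsize : s.wreg WordReg.size = n) (hone : s.wreg WordReg.one = 1)
    (hW : n < W) (hbuffer : ∀ k < n, s.wmem WordArray.buffer k < W) :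
    WP W copyBack (fun t s' => t ≤ n * 4 + 2 ∧
      ∀ k < n, s'.wmem WordArray.list k = s.wmem WordArray.buffer k) s := by
  refine .seq (.block (by simp; lia) ?_)
  refine (WP.forLoop (N := n) (C := 2)
    (fun k s' => ∀ q < k, s'.wmem WordArray.list q = s.wmem WordArray.buffer q)
    (by simp) (by simpa) (by simpa) rfl rfl rfl (by simp) (by simp) hW (by simp)
    fun k s' hk hf hi hI => ?_).mono fun t s' ⟨_, hI, _, _⟩ => ⟨?_, hI⟩
  · have hbuf : s'.wmem WordArray.buffer = s.wmem WordArray.buffer := hf.wmem _ rfl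
    refine .block (by simp_all) ⟨le_rfl, fun q hq => ?_⟩
    rcases Nat.lt_succ_iff_lt_or_eq.1 hq with hq | rfl
    · simpa [hi, Function.update_apply, hq.ne] using hI q hq
    · simp_all
  · simp only [List.length]
    lia

theorem mergePass_spec (hsize : s.wreg WordReg.size = n) (hone : s.wreg WordReg.one = 1)
    (hwidth : s.wreg WordReg.width = w) (hw₀ : 0 < w) (hw : w < n)
    (hW : 2 * n < W)
    (hperm : (slice (s.wmem WordArray.list) 0 n).Perm (List.range n))
    (hsort : BlockSorted (s.rmem RealArray.keys) w n (s.wmem WordArray.list)) :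
    WP W mergePass (fun t s' => t ≤ n * 28 + 5 ∧ s'.wreg WordReg.width = 2 * w ∧
      (slice (s'.wmem WordArray.list) 0 n).Perm (List.range n) ∧
      BlockSorted (s.rmem RealArray.keys) (2 * w) n (s'.wmem WordArray.list)) s := by
  refine .seq <| (mergeAllBlocks_spec hsize hone hwidth hw₀ hw hW
    (fun k hk => (lt_of_slice_perm_range hperm hk).trans (by lia)) hsort).frame.mono ?_
  rintro t₁ s₁ ⟨⟨ht₁, hp, hs⟩, hf₁⟩
  replace hp := hp.trans hperm
  refine .seq <| (copyBack_spec ((hf₁.wreg _ rfl).trans hsize) ((hf₁.wreg _ rfl).trans hone)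
    (by lia) fun k hk => (lt_of_slice_perm_range hp hk).trans (by lia)).frame.mono ?_
  rintro t₂ s₂ ⟨⟨ht₂, hcopy⟩, hf₂⟩
  have hwidth₂ : s₂.wreg WordReg.width = w :=
    (hf₂.wreg _ rfl).trans ((hf₁.wreg _ rfl).trans hwidth)
  refine .block (by simp [hwidth₂]; lia) ⟨?_, by simp [hwidth₂, two_mul], ?_, ?_⟩
  · simp only [List.length]
    lia
  · simpa [slice_congr fun k _ hk => hcopy k hk] using hp
  · simpa using hs.congr hcopy

theorem mergeSort_spec (hsize : s.wreg WordReg.size = n) (hone : s.wreg WordReg.one = 1)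
    (h1W : 1 < W) (hW : 2 * n < W)
    (hperm : (slice (s.wmem WordArray.list) 0 n).Perm (List.range n)) :
    WP W mergeSort (fun t s' => t ≤ Nat.clog 2 n * (n * 28 + 6) + 2 ∧
      (slice (s'.wmem WordArray.list) 0 n).Perm (List.range n) ∧
      ∀ p q, p < q → q < n → s.rmem RealArray.keys (s'.wmem WordArray.list p) ≤
        s.rmem RealArray.keys (s'.wmem WordArray.list q)) s := by
  refine .seq (.block (by simpa using h1W) ?_)
  refine (WP.whileDo_frame (fun s' => ∃ r, s'.wreg WordReg.width = 2 ^ r ∧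
    (slice (s'.wmem WordArray.list) 0 n).Perm (List.range n) ∧
    BlockSorted (s.rmem RealArray.keys) (s'.wreg WordReg.width) n (s'.wmem WordArray.list))
    (fun s' => (Nat.clog 2 n - Nat.log 2 (s'.wreg WordReg.width)) * (n * 28 + 6)) ?_
    ⟨0, by simp, by simpa, .one⟩).mono ?_
  · rintro s' hf ⟨r, hr, hp, hs⟩ hb
    have hsize' : s'.wreg WordReg.size = n := (hf.wreg _ rfl).trans hsize
    have hkeys : s'.rmem RealArray.keys = s.rmem RealArray.keys := hf.rmem _ rfl
    have hlt : 2 ^ r < n := hr ▸ hsize' ▸ hb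
    rw [hr] at hs
    refine (mergePass_spec hsize' ((hf.wreg _ rfl).trans hone) hr (Nat.two_pow_pos r) hlt hW hp
      (by rwa [hkeys])).mono ?_
    rintro t s'' ⟨ht, hwidth, hp', hs'⟩
    rw [← pow_succ'] at hwidth hs'
    rw [hwidth, hr, Nat.log_pow one_lt_two, Nat.log_pow one_lt_two]
    refine ⟨⟨r + 1, rfl, hp', hkeys ▸ hs'⟩, ?_⟩
    obtain ⟨m, hm⟩ := Nat.exists_eq_add_of_lt ((Nat.lt_clog_iff_pow_lt one_lt_two).2 hlt)
    rw [hm, show r + m + 1 - (r + 1) = m by lia, show r + m + 1 - r = m + 1 by lia]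
    lia
  · rintro t s' ⟨hf, ⟨r, -, hp, hs⟩, hb, ht⟩
    have hsize' : s'.wreg WordReg.size = n := (hf.wreg _ rfl).trans hsize
    simp only [Test.Holds, hsize', not_lt] at hb
    exact ⟨by simp at ht ⊢; lia, hp, fun p q => hs.le hb⟩

end RealRAM

/-! Sorting lines through a point by slope. -/

section slope

/-- `1` if `q` comes after `p` in the lexicographic order, else `-1`. -/
noncomputable def lexSign (p q : ℝ × ℝ) : ℤ := if toLex p < toLex q then 1 else -1

/-- The vector from `p` to `q`, reflected so that it points to the right (or up). -/
noncomputable def rightward (p q : ℝ × ℝ) : ℝ × ℝ := (lexSign p q : ℝ) • (q - p)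

/-- The slope of the line through `p` and `q`, mapped to the interval `(-1, 1]` by a monotone
function that is also defined for vertical lines. For `p = q` the value is `0 / 0 = 0`. -/
noncomputable def slopeKey (p q : ℝ × ℝ) : ℝ :=
  (rightward p q).2 / ((rightward p q).1 + |(rightward p q).2|)

variable {p q r : ℝ × ℝ}

theorem lexSign_mul_lexSign_swap (h : p ≠ q) : lexSign p q * lexSign q p = -1 := by
  rcases lt_or_gt_of_ne (toLex.injective.ne h) with h | h <;> simp [lexSign, h, h.not_gt]

theorem lexSign_eq_one_or_neg_one (p q : ℝ × ℝ) : lexSign p q = 1 ∨ lexSign p q = -1 :=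
  ite_eq_or_eq ..

theorem zero_lt_toLex_rightward (h : p ≠ q) : 0 < toLex (rightward p q) := by
  rcases lt_or_gt_of_ne (toLex.injective.ne h) with h | h
  · simp [rightward, lexSign, h]
  · simpa [rightward, lexSign, h.not_gt] using h

theorem add_abs_pos_of_zero_lt_toLex {𝕜 : Type*} [Field 𝕜] [LinearOrder 𝕜] [IsStrictOrderedRing 𝕜]
    {a : 𝕜 × 𝕜} (ha : 0 < toLex a) : 0 < a.1 + |a.2| := by
  rcases Prod.Lex.toLex_lt_toLex.1 ha with h | ⟨h, h'⟩
  · exact add_pos_of_pos_of_nonneg h (abs_nonneg _)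
  · exact add_pos_of_nonneg_of_pos h.le (abs_pos_of_pos h')

theorem div_add_abs_lt_div_add_abs_iff {𝕜 : Type*} [Field 𝕜] [LinearOrder 𝕜]
    [IsStrictOrderedRing 𝕜] {a b : 𝕜 × 𝕜} (ha : 0 < toLex a) (hb : 0 < toLex b) :
    a.2 / (a.1 + |a.2|) < b.2 / (b.1 + |b.2|) ↔ 0 < a.1 * b.2 - a.2 * b.1 := by
  rw [div_lt_div_iff₀ (add_abs_pos_of_zero_lt_toLex ha) (add_abs_pos_of_zero_lt_toLex hb)]
  have hnonneg {c : 𝕜 × 𝕜} (hc : 0 < toLex c) : 0 ≤ c.1 :=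
    (Prod.Lex.toLex_lt_toLex.1 hc).elim le_of_lt fun h => h.1.le
  have hpos {c : 𝕜 × 𝕜} (hc : 0 < toLex c) (h : c.2 < 0) : 0 < c.1 :=
    (Prod.Lex.toLex_lt_toLex.1 hc).resolve_right fun h' => h.not_gt h'.2
  rcases le_or_gt 0 a.2 with ha₂ | ha₂ <;> rcases le_or_gt 0 b.2 with hb₂ | hb₂
  · rw [abs_of_nonneg ha₂, abs_of_nonneg hb₂]
    constructor <;> intro h <;> linarith
  · rw [abs_of_nonneg ha₂, abs_of_neg hb₂]
    have := mul_nonneg ha₂ (hpos hb hb₂).le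
    have := mul_nonneg (hnonneg ha) (neg_nonneg.2 hb₂.le)
    have := mul_nonneg ha₂ (neg_nonneg.2 hb₂.le)
    constructor <;> intro h <;> nlinarith
  · rw [abs_of_neg ha₂, abs_of_nonneg hb₂]
    have hcross : 0 < a.1 * b.2 - a.2 * b.1 := by
      rcases Prod.Lex.toLex_lt_toLex.1 hb with hb₁ | ⟨hb₁, hb₂⟩
      · nlinarith [mul_pos (neg_pos.2 ha₂) hb₁, mul_nonneg (hpos ha ha₂).le hb₂]
      · rw [← hb₁]
        simpa using mul_pos (hpos ha ha₂) hb₂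
    have := mul_nonneg (neg_nonneg.2 ha₂.le) hb₂
    exact iff_of_true (by nlinarith) hcross
  · rw [abs_of_neg ha₂, abs_of_neg hb₂]
    constructor <;> intro h <;> linarith

theorem slopeKey_lt_slopeKey_iff (hq : p ≠ q) (hr : p ≠ r) :
    slopeKey p q < slopeKey p r ↔ 0 < ((lexSign p q * lexSign p r : ℤ) : ℝ) *
      ((q.1 - p.1) * (r.2 - p.2) - (q.2 - p.2) * (r.1 - p.1)) := by
  rw [slopeKey, slopeKey, div_add_abs_lt_div_add_abs_iff (zero_lt_toLex_rightward hq)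
    (zero_lt_toLex_rightward hr)]
  simp only [rightward, Prod.smul_fst, Prod.smul_snd, Prod.fst_sub, Prod.snd_sub, smul_eq_mul,
    Int.cast_mul]
  ring_nf

theorem ite_slopeKey_lt_slopeKey (hq : p ≠ q) (hr : p ≠ r)
    (h : (q.1 - p.1) * (r.2 - p.2) - (q.2 - p.2) * (r.1 - p.1) ≠ 0) :
    (if slopeKey p q < slopeKey p r then 1 else -1) = lexSign p q * lexSign p r *
      SignType.sign ((q.1 - p.1) * (r.2 - p.2) - (q.2 - p.2) * (r.1 - p.1)) := by
  rw [if_congr (slopeKey_lt_slopeKey_iff hq hr) rfl rfl]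
  generalize (q.1 - p.1) * (r.2 - p.2) - (q.2 - p.2) * (r.1 - p.1) = x at h
  rcases lexSign_eq_one_or_neg_one p q with hq | hq <;>
    rcases lexSign_eq_one_or_neg_one p r with hr | hr <;>
    rcases h.lt_or_gt with h | h <;> simp [hq, hr, h, h.le]

theorem slopeKey_ne_slopeKey (hq : p ≠ q) (hr : p ≠ r)
    (h : (q.1 - p.1) * (r.2 - p.2) - (q.2 - p.2) * (r.1 - p.1) ≠ 0) :
    slopeKey p q ≠ slopeKey p r := by
  intro heq
  have hqr := (slopeKey_lt_slopeKey_iff hq hr).not.1 heq.not_lt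
  have hrq := (slopeKey_lt_slopeKey_iff hr hq).not.1 heq.not_gt
  refine mul_ne_zero (a := ((lexSign p q * lexSign p r : ℤ) : ℝ)) ?_ h ?_
  · rcases lexSign_eq_one_or_neg_one p q with hq | hq <;>
      rcases lexSign_eq_one_or_neg_one p r with hr | hr <;> simp [hq, hr]
  · push_cast at hqr hrq ⊢
    linarith

end slope

section sweep

/-- The total weight of the points other than `w`, where the weight of a point `u` is `p u` if its
key exceeds that of `w`, and `q u` if not. -/
noncomputable def sideCount (κ : ℕ → ℝ) (p q : ℕ → ℕ) (n w : ℕ) : ℕ :=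
  ∑ u ∈ (Finset.range n).erase w, if κ w < κ u then p u else q u

/-- The counter of a sweep that replaces the weights `p j` by `q j` one after another. -/
def sweepCount (p q : ℕ → ℕ) (n k : ℕ) : ℕ :=
  ∑ j ∈ Finset.range n, if j < k then q j else p j

/-- The counter of a sweep that is about to add the weight `q k`, having removed `p k`. -/
def sweepRest (p q : ℕ → ℕ) (n k : ℕ) : ℕ :=
  ∑ j ∈ (Finset.range n).erase k, if j < k then q j else p j

variable {κ : ℕ → ℝ} {p q A : ℕ → ℕ} {n k : ℕ}

theorem sum_le_of_le_one {f : ℕ → ℕ} (h : ∀ j < n, f j ≤ 1) : ∑ j ∈ Finset.range n, f j ≤ n := by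
  simpa using Finset.sum_le_card_nsmul (Finset.range n) f 1 fun j hj => h j (Finset.mem_range.1 hj)

theorem sideCount_le (w : ℕ) (hp : ∀ u < n, p u ≤ 1) (hq : ∀ u < n, q u ≤ 1) :
    sideCount κ p q n w ≤ n :=
  (Finset.sum_le_sum_of_subset (Finset.erase_subset w _)).trans <| sum_le_of_le_one fun u hu => by
    split_ifs
    exacts [hp u hu, hq u hu]

theorem sweepCount_le (k : ℕ) (hp : ∀ u < n, p u ≤ 1) (hq : ∀ u < n, q u ≤ 1) :
    sweepCount p q n k ≤ n :=
  sum_le_of_le_one fun u hu => by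
    split_ifs
    exacts [hq u hu, hp u hu]

theorem sweepCount_zero : sweepCount p q n 0 = ∑ j ∈ Finset.range n, p j := by
  simp [sweepCount]

theorem sweepCount_eq_sweepRest_add (hk : k < n) :
    sweepCount p q n k = sweepRest p q n k + p k := by
  rw [sweepCount, ← Finset.sum_erase_add _ _ (Finset.mem_range.2 hk), if_neg (lt_irrefl k),
    sweepRest]

theorem sweepCount_succ_eq_sweepRest_add (hk : k < n) :
    sweepCount p q n (k + 1) = sweepRest p q n k + q k := by
  rw [sweepCount, ← Finset.sum_erase_add _ _ (Finset.mem_range.2 hk), if_pos k.lt_succ_self,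
    sweepRest]
  congr 1
  refine Finset.sum_congr rfl fun j hj => if_congr ?_ rfl rfl
  have := Finset.ne_of_mem_erase hj
  lia

theorem bijOn_of_slice_perm_range (hA : (slice A 0 n).Perm (List.range n)) :
    Set.BijOn A (Finset.range n) (Finset.range n) := by
  have hmem (u : ℕ) : u < n ↔ ∃ j < n, A j = u := by
    simpa [mem_slice, eq_comm] using (hA.mem_iff (a := u)).symm
  have hne := pairwise_slice.1 (hA.nodup_iff.2 List.nodup_range)
  refine ⟨fun j hj => ?_, fun i hi j hj hij => ?_, fun u hu => ?_⟩
  · simp only [Finset.coe_range, Set.mem_Iio] at hj ⊢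
    exact (hmem _).2 ⟨j, hj, rfl⟩
  · simp only [Finset.coe_range, Set.mem_Iio] at hi hj
    by_contra h
    rcases lt_or_gt_of_ne h with h | h
    · exact hne i j i.zero_le h hj hij
    · exact hne j i j.zero_le h hi hij.symm
  · simpa using (hmem u).1 (by simpa using hu)

theorem sum_comp_of_slice_perm_range (hA : (slice A 0 n).Perm (List.range n)) (f : ℕ → ℕ) :
    ∑ j ∈ Finset.range n, f (A j) = ∑ u ∈ Finset.range n, f u :=
  have h := bijOn_of_slice_perm_range hA
  Finset.sum_nbij A h.mapsTo h.injOn h.surjOn fun _ _ => rfl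

theorem sweepRest_eq_sideCount (hA : (slice A 0 n).Perm (List.range n))
    (hsort : ∀ i j, i < j → j < n → κ (A i) ≤ κ (A j)) (hk : k < n)
    (htie : ∀ u < n, u ≠ A k → κ u = κ (A k) → p u = 0 ∧ q u = 0) :
    sweepRest (p ∘ A) (q ∘ A) n k = sideCount κ p q n (A k) := by
  have h := bijOn_of_slice_perm_range hA
  have hkmem : k ∈ (Finset.range n : Set ℕ) := by simpa using hk
  have herase := h.sdiff_singleton hkmem
  rw [← Finset.coe_erase, ← Finset.coe_erase] at herase
  refine Finset.sum_nbij A herase.mapsTo herase.injOn herase.surjOn fun j hj => ?_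
  obtain ⟨hne, hAj⟩ := Finset.mem_erase.1 (herase.mapsTo hj)
  obtain ⟨hjk, hj⟩ := Finset.mem_erase.1 hj
  rw [Finset.mem_range] at hAj hj
  rcases lt_or_gt_of_ne hjk with h | h
  · simp [h, (hsort j k h hk).not_gt]
  rcases (hsort k j h hj).lt_or_eq with hκ | hκ
  · simp [h.not_gt, hκ]
  · simp [htie _ hAj hne hκ.symm]

end sweep

namespace RealRAM

/-! The neighbours of a vertex on either side of the lines through it. -/

namespace WordReg

@[simp] abbrev center : ℕ := 11
@[simp] abbrev other : ℕ := 12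
@[simp] abbrev row : ℕ := 13
@[simp] abbrev bit : ℕ := 14
@[simp] abbrev index : ℕ := 15
@[simp] abbrev adj : ℕ := 16
@[simp] abbrev later : ℕ := 17
@[simp] abbrev earlier : ℕ := 18
@[simp] abbrev above : ℕ := 19
@[simp] abbrev below : ℕ := 20
@[simp] abbrev degree : ℕ := 21
@[simp] abbrev product : ℕ := 22
@[simp] abbrev excess : ℕ := 23

end WordReg

namespace RealReg

@[simp] abbrev centerFst : ℕ := 2
@[simp] abbrev centerSnd : ℕ := 3
@[simp] abbrev otherFst : ℕ := 4
@[simp] abbrev otherSnd : ℕ := 5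
@[simp] abbrev vecFst : ℕ := 6
@[simp] abbrev vecSnd : ℕ := 7
@[simp] abbrev zero : ℕ := 8
@[simp] abbrev denom : ℕ := 9

end RealReg

namespace WordArray

@[simp] abbrev adjacency : ℕ := 0
@[simp] abbrev later : ℕ := 3
@[simp] abbrev earlier : ℕ := 4
@[simp] abbrev above : ℕ := 5
@[simp] abbrev below : ℕ := 6

end WordArray

namespace RealArray

@[simp] abbrev fst : ℕ := 0
@[simp] abbrev snd : ℕ := 1

end RealArray

/-- Compute the vector from the point `center` to the point `other`. -/
def forwardVector : Program :=
  block [.rop .sub RealReg.vecFst RealReg.otherFst RealReg.centerFst,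
    .rop .sub RealReg.vecSnd RealReg.otherSnd RealReg.centerSnd, .wconst WordReg.bit 1]

/-- Compute the vector from the point `other` to the point `center`. -/
def backwardVector : Program :=
  block [.rop .sub RealReg.vecFst RealReg.centerFst RealReg.otherFst,
    .rop .sub RealReg.vecSnd RealReg.centerSnd RealReg.otherSnd, .wconst WordReg.bit 0]

/-- Compute `rightward` of the points `center` and `other`; `bit` is `1` if `other` comes after
`center` in the lexicographic order. -/
def rightwardVector : Program :=
  .seq
    (block [.rload RealReg.centerFst RealArray.fst WordReg.center,
      .rload RealReg.centerSnd RealArray.snd WordReg.center,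
      .rload RealReg.otherFst RealArray.fst WordReg.other,
      .rload RealReg.otherSnd RealArray.snd WordReg.other])
    (.ifThenElse (.rlt RealReg.centerFst RealReg.otherFst) forwardVector
      (.ifThenElse (.rlt RealReg.otherFst RealReg.centerFst) backwardVector
        (.ifThenElse (.rlt RealReg.centerSnd RealReg.otherSnd) forwardVector backwardVector)))

/-- Compute `slopeKey` of the points `center` and `other`, with a case distinction for `0 / 0`. -/
def computeKey : Program :=
  .seq rightwardVector
    (.seq (block [.rop .sub RealReg.zero RealReg.vecFst RealReg.vecFst])
      (.seq
        (.ifThenElse (.rlt RealReg.vecSnd RealReg.zero)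
          (block [.rop .sub RealReg.denom RealReg.vecFst RealReg.vecSnd])
          (block [.rop .add RealReg.denom RealReg.vecFst RealReg.vecSnd]))
        (.ifThenElse (.req RealReg.denom RealReg.zero)
          (block [.rop .sub RealReg.key RealReg.zero RealReg.zero])
          (block [.rop .div RealReg.key RealReg.vecSnd RealReg.denom]))))

/-- Append `other` to the list, store its key and its weights in the sweep around `center`, and add
the weights to the counters. -/
def addOther : Program :=
  .seq computeKey
    (block [.rstore RealArray.keys WordReg.other RealReg.key,
      .wstore WordArray.list WordReg.other WordReg.other,
      .wop .add WordReg.index WordReg.row WordReg.other,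
      .wload WordReg.adj WordArray.adjacency WordReg.index,
      .wop .mul WordReg.later WordReg.adj WordReg.bit,
      .wop .sub WordReg.earlier WordReg.adj WordReg.later,
      .wstore WordArray.later WordReg.other WordReg.later,
      .wstore WordArray.earlier WordReg.other WordReg.earlier,
      .wop .add WordReg.above WordReg.above WordReg.later,
      .wop .add WordReg.below WordReg.below WordReg.earlier])

/-- Rotate the line through `center` past the next point of the list. The numbers of neighbours on
either side are stored while the line goes through this point. -/
def sweepStep : Program :=
  block [.wload WordReg.entry WordArray.list WordReg.other,
    .wload WordReg.later WordArray.later WordReg.entry,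
    .wload WordReg.earlier WordArray.earlier WordReg.entry,
    .wop .sub WordReg.above WordReg.above WordReg.later,
    .wop .sub WordReg.below WordReg.below WordReg.earlier,
    .wop .add WordReg.index WordReg.row WordReg.entry,
    .wstore WordArray.above WordReg.index WordReg.above,
    .wstore WordArray.below WordReg.index WordReg.below,
    .wop .add WordReg.above WordReg.above WordReg.earlier,
    .wop .add WordReg.below WordReg.below WordReg.later]

/-- Sort the points by their keys and rotate a line through `center` past all of them. -/
def sweep : Program :=
  .seq mergeSort
    (.seq (block [.wconst WordReg.other 0])
      (forLoop WordReg.other WordReg.size WordReg.one sweepStep))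

/-- Add `d * (d - 1)` to `excess`, where `d` is the degree of `center`. -/
def addExcess : Program :=
  block [.wop .add WordReg.degree WordReg.above WordReg.below,
    .wop .sub WordReg.product WordReg.degree WordReg.one,
    .wop .mul WordReg.product WordReg.degree WordReg.product,
    .wop .add WordReg.excess WordReg.excess WordReg.product]

/-- Count the neighbours of `center` on either side of all lines through it, and add `d * (d - 1)`
to `excess`, where `d` is the degree. -/
def vertexPhase : Program :=
  .seq
    (block [.wop .mul WordReg.row WordReg.center WordReg.size, .wconst WordReg.other 0,
      .wconst WordReg.above 0, .wconst WordReg.below 0])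
    (.seq (forLoop WordReg.other WordReg.size WordReg.one addOther) (.seq addExcess sweep))

variable {W n v u : ℕ} {a : ℕ → ℕ → ℕ} {P : ℕ → ℝ × ℝ} {p q : ℕ → ℕ} {s s' : State}
  {prog : Program}

/-- `a v u` if the point `u` comes after the point `v` in the lexicographic order, else `0`. -/
noncomputable def later (a : ℕ → ℕ → ℕ) (P : ℕ → ℝ × ℝ) (v u : ℕ) : ℕ :=
  if toLex (P v) < toLex (P u) then a v u else 0

/-- `a v u` if the point `u` does not come after the point `v` in the lexicographic order,
else `0`. -/
noncomputable def earlier (a : ℕ → ℕ → ℕ) (P : ℕ → ℝ × ℝ) (v u : ℕ) : ℕ :=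
  if toLex (P v) < toLex (P u) then 0 else a v u

theorem later_add_earlier (a : ℕ → ℕ → ℕ) (P : ℕ → ℝ × ℝ) (v u : ℕ) :
    later a P v u + earlier a P v u = a v u := by
  rw [later, earlier]
  split_ifs <;> simp

theorem later_le (h : a v u ≤ 1) : later a P v u ≤ 1 :=
  (Nat.le_add_right _ _).trans (later_add_earlier a P v u ▸ h)

theorem earlier_le (h : a v u ≤ 1) : earlier a P v u ≤ 1 :=
  (Nat.le_add_left _ _).trans (later_add_earlier a P v u ▸ h)

/-- The number of neighbours of `v` above the line through `v` and `w`. -/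
noncomputable def nbrsAbove (n : ℕ) (a : ℕ → ℕ → ℕ) (P : ℕ → ℝ × ℝ) (v w : ℕ) : ℕ :=
  sideCount (fun u => slopeKey (P v) (P u)) (later a P v) (earlier a P v) n w

/-- The number of neighbours of `v` below the line through `v` and `w`. -/
noncomputable def nbrsBelow (n : ℕ) (a : ℕ → ℕ → ℕ) (P : ℕ → ℝ × ℝ) (v w : ℕ) : ℕ :=
  sideCount (fun u => slopeKey (P v) (P u)) (earlier a P v) (later a P v) n w

/-- The state holds the adjacency matrix `a` and the points `P` of a graph on `n` vertices, as well
as the constant `1`. -/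
structure Encodes (n : ℕ) (a : ℕ → ℕ → ℕ) (P : ℕ → ℝ × ℝ) (s : State) : Prop where
  size : s.wreg WordReg.size = n
  one : s.wreg WordReg.one = 1
  adj : ∀ v < n, ∀ u < n, s.wmem WordArray.adjacency (v * n + u) = a v u
  fst : ∀ v < n, s.rmem RealArray.fst v = (P v).1
  snd : ∀ v < n, s.rmem RealArray.snd v = (P v).2

theorem Encodes.frame (h : Encodes n a P s) (hf : Frame prog s s')
    (hp : [.wreg WordReg.size, .wreg WordReg.one, .wmem WordArray.adjacency, .rmem RealArray.fst,
      .rmem RealArray.snd].any prog.writes = false) : Encodes n a P s' := by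
  simp only [List.any_cons, List.any_nil, Bool.or_false, Bool.or_eq_false_iff] at hp
  obtain ⟨hsize, hone, hadj, hfst, hsnd⟩ := hp
  exact ⟨(hf.wreg _ hsize).trans h.size, (hf.wreg _ hone).trans h.one, hf.wmem _ hadj ▸ h.adj,
    hf.rmem _ hfst ▸ h.fst, hf.rmem _ hsnd ▸ h.snd⟩

theorem mul_add_lt_mul (hv : v < n) (hu : u < n) : v * n + u < n * n :=
  (Nat.add_lt_add_left hu _).trans_le (Nat.succ_mul v n ▸ Nat.mul_le_mul_right n hv)

theorem rightwardVector_spec (hs : Encodes n a P s) (hv : s.wreg WordReg.center = v)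
    (hu : s.wreg WordReg.other = u) (hvn : v < n) (hun : u < n) (hW : 1 < W) :
    WP W rightwardVector (fun t s' => t ≤ 10 ∧
      s'.rreg RealReg.vecFst = (rightward (P v) (P u)).1 ∧
      s'.rreg RealReg.vecSnd = (rightward (P v) (P u)).2 ∧
      s'.wreg WordReg.bit = if toLex (P v) < toLex (P u) then 1 else 0) s := by
  refine .seq (.block (by simp) ?_)
  generalize hs₁ : blockEffect _ s = s₁
  have hv₁ : s₁.rreg RealReg.centerFst = (P v).1 := by simp [← hs₁, hv, hs.fst v hvn]
  have hv₂ : s₁.rreg RealReg.centerSnd = (P v).2 := by simp [← hs₁, hv, hs.snd v hvn]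
  have hu₁ : s₁.rreg RealReg.otherFst = (P u).1 := by simp [← hs₁, hu, hs.fst u hun]
  have hu₂ : s₁.rreg RealReg.otherSnd = (P u).2 := by simp [← hs₁, hu, hs.snd u hun]
  have hlex : toLex (P v) < toLex (P u) ↔ s₁.rreg RealReg.centerFst < s₁.rreg RealReg.otherFst ∨
      s₁.rreg RealReg.centerFst = s₁.rreg RealReg.otherFst ∧
        s₁.rreg RealReg.centerSnd < s₁.rreg RealReg.otherSnd := by
    rw [hv₁, hv₂, hu₁, hu₂, Prod.Lex.toLex_lt_toLex]
  refine .ifThenElse (fun h₁ => ?_) fun h₁ => .ifThenElse (fun h₂ => ?_) fun h₂ =>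
    .ifThenElse (fun h₃ => ?_) fun h₃ => ?_
  · have hlt := hlex.2 (.inl h₁)
    exact .block (by simpa) (by simp [rightward, lexSign, hlt, hv₁, hv₂, hu₁, hu₂])
  · have hlt := hlex.not.2 fun h => h.elim h₁ fun h => (ne_of_lt h₂).symm h.1
    exact .block (by simp; lia) (by simp [rightward, lexSign, hlt, hv₁, hv₂, hu₁, hu₂])
  · have hlt := hlex.2 (.inr ⟨le_antisymm (not_lt.1 h₂) (not_lt.1 h₁), h₃⟩)
    exact .block (by simpa) (by simp [rightward, lexSign, hlt, hv₁, hv₂, hu₁, hu₂])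
  · have hlt := hlex.not.2 fun h => h.elim h₁ fun h => h₃ h.2
    exact .block (by simp; lia) (by simp [rightward, lexSign, hlt, hv₁, hv₂, hu₁, hu₂])

theorem computeKey_spec (hs : Encodes n a P s) (hv : s.wreg WordReg.center = v)
    (hu : s.wreg WordReg.other = u) (hvn : v < n) (hun : u < n) (hW : 1 < W) :
    WP W computeKey (fun t s' => t ≤ 15 ∧ s'.rreg RealReg.key = slopeKey (P v) (P u) ∧
      s'.wreg WordReg.bit = if toLex (P v) < toLex (P u) then 1 else 0) s := by
  refine .seq ((rightwardVector_spec hs hv hu hvn hun hW).mono ?_)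
  rintro t s' ⟨ht, hx, hy, hbit⟩
  rw [← hbit, slopeKey, ← hx, ← hy]
  refine .seq (.block (by simp) (.seq (.ifThenElse (fun hneg => ?_) fun hneg => ?_)))
  all_goals
    simp only [Test.Holds, blockEffect, Instr.effect, RealOp.val, State.setReal_rreg, sub_self,
      if_true, not_lt] at hneg
    refine .block (by simp) (.ifThenElse (fun h0 => .block (by simp) ?_)
      fun h0 => .block (by simpa [Test.Holds] using h0) ?_)
  all_goals simp [Test.Holds] at h0 hneg ⊢
  · simp [abs_of_neg hneg, ← sub_eq_add_neg, h0]; lia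
  · simp [abs_of_neg hneg, ← sub_eq_add_neg]; lia
  · simp [abs_of_nonneg hneg, h0]; lia
  · simp [abs_of_nonneg hneg]; lia

theorem addOther_spec {S T : ℕ} (hs : Encodes n a P s) (hv : s.wreg WordReg.center = v)
    (hu : s.wreg WordReg.other = u) (hrow : s.wreg WordReg.row = v * n) (hvn : v < n) (hun : u < n)
    (habove : s.wreg WordReg.above = S) (hbelow : s.wreg WordReg.below = T)
    (ha : a v u ≤ 1) (hS : S + 1 < W) (hT : T + 1 < W) (hW : n * n < W) :
    WP W addOther (fun t s' => t ≤ 25 ∧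
      s'.rmem RealArray.keys =
        Function.update (s.rmem RealArray.keys) u (slopeKey (P v) (P u)) ∧
      s'.wmem WordArray.list = Function.update (s.wmem WordArray.list) u u ∧
      s'.wmem WordArray.later = Function.update (s.wmem WordArray.later) u (later a P v u) ∧
      s'.wmem WordArray.earlier = Function.update (s.wmem WordArray.earlier) u (earlier a P v u) ∧
      s'.wreg WordReg.above = S + later a P v u ∧
      s'.wreg WordReg.below = T + earlier a P v u) s := by
  refine .seq ((computeKey_spec hs hv hu hvn hun (by lia)).frame.mono ?_)
  rintro t s' ⟨⟨ht, hkey, hbit⟩, hf⟩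
  have hlater : a v u * s'.wreg WordReg.bit = later a P v u := by simp [hbit, later]
  clear hbit
  have hearlier : a v u - later a P v u = earlier a P v u :=
    Nat.sub_eq_of_eq_add' (later_add_earlier a P v u).symm
  have hle := later_le (P := P) ha
  have hle' := earlier_le (P := P) ha
  have hindex := mul_add_lt_mul hvn hun
  have hu' := (hf.wreg WordReg.other rfl).trans hu
  have hrow' := (hf.wreg WordReg.row rfl).trans hrow
  have habove' := (hf.wreg WordReg.above rfl).trans habove
  have hbelow' := (hf.wreg WordReg.below rfl).trans hbelow
  have hadj := (hs.frame hf rfl).adj v hvn u hun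
  have hkeys := hf.rmem RealArray.keys rfl
  have hlist := hf.wmem WordArray.list rfl
  have hlaterArray := hf.wmem WordArray.later rfl
  have hearlierArray := hf.wmem WordArray.earlier rfl
  refine .block ?_ ⟨by simp only [List.length]; lia, ?_⟩
  · simp [*]
    lia
  · simp [*]

theorem addOtherLoop_spec (hs : Encodes n a P s) (hv : s.wreg WordReg.center = v)
    (hu : s.wreg WordReg.other = 0) (hrow : s.wreg WordReg.row = v * n) (hvn : v < n)
    (habove : s.wreg WordReg.above = 0) (hbelow : s.wreg WordReg.below = 0)
    (ha : ∀ u < n, a v u ≤ 1) (hW : n * n + 1 < W) :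
    WP W (forLoop WordReg.other WordReg.size WordReg.one addOther) (fun t s' => t ≤ n * 27 + 1 ∧
      (∀ u < n, s'.rmem RealArray.keys u = slopeKey (P v) (P u) ∧ s'.wmem WordArray.list u = u ∧
        s'.wmem WordArray.later u = later a P v u ∧
        s'.wmem WordArray.earlier u = earlier a P v u) ∧
      s'.wreg WordReg.above = ∑ u ∈ Finset.range n, later a P v u ∧
      s'.wreg WordReg.below = ∑ u ∈ Finset.range n, earlier a P v u) s := by
  have hn : n ≤ n * n := Nat.le_mul_self n
  refine (WP.forLoop (N := n) (C := 25) (fun k s' =>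
    (∀ u < k, s'.rmem RealArray.keys u = slopeKey (P v) (P u) ∧ s'.wmem WordArray.list u = u ∧
      s'.wmem WordArray.later u = later a P v u ∧
      s'.wmem WordArray.earlier u = earlier a P v u) ∧
    s'.wreg WordReg.above = ∑ u ∈ Finset.range k, later a P v u ∧
    s'.wreg WordReg.below = ∑ u ∈ Finset.range k, earlier a P v u) hu hs.size hs.one rfl rfl rfl
    (by simp) (by simp) (by lia) (by simp [habove, hbelow])
    fun k s' hk hf hi ⟨hI, habove', hbelow'⟩ => ?_).mono fun t s' ⟨_, hI, _, ht⟩ => ⟨ht, hI⟩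
  refine (addOther_spec (hs.frame hf rfl) ((hf.wreg _ rfl).trans hv) hi
    ((hf.wreg _ rfl).trans hrow) hvn hk habove' hbelow' (ha k hk) ?_ ?_ (by lia)).mono ?_
  · have := sum_le_of_le_one fun u hu => later_le (P := P) (ha u (hu.trans hk))
    lia
  · have := sum_le_of_le_one fun u hu => earlier_le (P := P) (ha u (hu.trans hk))
    lia
  · rintro t s'' ⟨ht, hkeys, hlist, hlater, hearlier, habove'', hbelow''⟩
    refine ⟨ht, fun u hu => ?_, by simp [habove'', Finset.sum_range_succ],
      by simp [hbelow'', Finset.sum_range_succ]⟩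
    rcases Nat.lt_succ_iff_lt_or_eq.1 hu with hu | rfl
    · simpa [hkeys, hlist, hlater, hearlier, hu.ne] using hI u hu
    · simp [hkeys, hlist, hlater, hearlier]

theorem sweepStep_spec {r c d : ℕ} (hrow : s.wreg WordReg.row = r)
    (hu : s.wmem WordArray.list (s.wreg WordReg.other) = u)
    (hlater : s.wmem WordArray.later u = p u) (hearlier : s.wmem WordArray.earlier u = q u)
    (habove : s.wreg WordReg.above = c + p u) (hbelow : s.wreg WordReg.below = d + q u)
    (hW : r + u < W) (hc : c + p u < W) (hd : d + q u < W) (hc' : c + q u < W) (hd' : d + p u < W) :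
    WP W sweepStep (fun t s' => t ≤ 10 ∧
      s'.wmem WordArray.above = Function.update (s.wmem WordArray.above) (r + u) c ∧
      s'.wmem WordArray.below = Function.update (s.wmem WordArray.below) (r + u) d ∧
      s'.wreg WordReg.above = c + q u ∧ s'.wreg WordReg.below = d + p u) s := by
  refine .block ?_ ⟨le_rfl, ?_⟩
  · simp [*]
    lia
  · simp [*]

theorem sweepLoop_spec {r : ℕ} {A : ℕ → ℕ} (hsize : s.wreg WordReg.size = n)
    (hone : s.wreg WordReg.one = 1) (hother : s.wreg WordReg.other = 0)
    (hrow : s.wreg WordReg.row = r) (hlist : s.wmem WordArray.list = A)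
    (hA : (slice A 0 n).Perm (List.range n))
    (hlater : ∀ u < n, s.wmem WordArray.later u = p u)
    (hearlier : ∀ u < n, s.wmem WordArray.earlier u = q u)
    (habove : s.wreg WordReg.above = ∑ u ∈ Finset.range n, p u)
    (hbelow : s.wreg WordReg.below = ∑ u ∈ Finset.range n, q u)
    (hp : ∀ u < n, p u ≤ 1) (hq : ∀ u < n, q u ≤ 1) (hW : r + n < W) :
    WP W (forLoop WordReg.other WordReg.size WordReg.one sweepStep) (fun t s' => t ≤ n * 12 + 1 ∧
      (∀ k < n, s'.wmem WordArray.above (r + A k) = sweepRest (p ∘ A) (q ∘ A) n k ∧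
        s'.wmem WordArray.below (r + A k) = sweepRest (q ∘ A) (p ∘ A) n k) ∧
      ∀ i < r, s'.wmem WordArray.above i = s.wmem WordArray.above i ∧
        s'.wmem WordArray.below i = s.wmem WordArray.below i) s := by
  have hAn {k : ℕ} (hk : k < n) : A k < n := lt_of_slice_perm_range hA hk
  have hpA (k : ℕ) (hk : k < n) : (p ∘ A) k ≤ 1 := hp _ (hAn hk)
  have hqA (k : ℕ) (hk : k < n) : (q ∘ A) k ≤ 1 := hq _ (hAn hk)
  refine (WP.forLoop (N := n) (C := 10) (fun k s' =>
    s'.wreg WordReg.above = sweepCount (p ∘ A) (q ∘ A) n k ∧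
    s'.wreg WordReg.below = sweepCount (q ∘ A) (p ∘ A) n k ∧
    (∀ j < k, s'.wmem WordArray.above (r + A j) = sweepRest (p ∘ A) (q ∘ A) n j ∧
      s'.wmem WordArray.below (r + A j) = sweepRest (q ∘ A) (p ∘ A) n j) ∧
    ∀ i < r, s'.wmem WordArray.above i = s.wmem WordArray.above i ∧
      s'.wmem WordArray.below i = s.wmem WordArray.below i) hother hsize hone rfl rfl rfl
    (by simp) (by simp) (by lia) ?_ fun k s' hk hf hi ⟨habove', hbelow', hI, hpre⟩ => ?_).mono
    fun t s' ⟨_, ⟨_, _, hI, hpre⟩, _, ht⟩ => ⟨ht, hI, hpre⟩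
  · simp [sweepCount_zero, habove, hbelow, sum_comp_of_slice_perm_range hA]
  have hlist' := (hf.wmem WordArray.list rfl).trans hlist
  have hle := sweepCount_le k hpA hqA
  have hle' := sweepCount_le k hqA hpA
  have hle₁ := sweepCount_le (k + 1) hpA hqA
  have hle₁' := sweepCount_le (k + 1) hqA hpA
  rw [sweepCount_eq_sweepRest_add hk] at habove' hbelow' hle hle'
  rw [sweepCount_succ_eq_sweepRest_add hk] at hle₁ hle₁'
  simp only [Function.comp_apply] at habove' hbelow' hle hle' hle₁ hle₁'
  have hAk := hAn hk
  refine (sweepStep_spec ((hf.wreg _ rfl).trans hrow) (u := A k) (by rw [hi, hlist'])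
    (by rw [hf.wmem _ rfl, hlater _ hAk]) (by rw [hf.wmem _ rfl, hearlier _ hAk]) habove' hbelow'
    (by lia) (by lia) (by lia) (by lia) (by lia)).mono ?_
  rintro t s'' ⟨ht, haboves, hbelows, habove'', hbelow''⟩
  rw [sweepCount_succ_eq_sweepRest_add hk, sweepCount_succ_eq_sweepRest_add hk]
  refine ⟨ht, by simp [habove''], by simp [hbelow''], fun j hj => ?_, fun i hi => ?_⟩
  · rcases Nat.lt_succ_iff_lt_or_eq.1 hj with hj | rfl
    · have hne := (bijOn_of_slice_perm_range hA).injOn.ne (by simpa using hj.trans hk)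
        (by simpa using hk) hj.ne
      simpa [haboves, hbelows, hne] using hI j hj
    · simp [haboves, hbelows]
  · simpa [haboves, hbelows, show i ≠ r + A k by lia] using hpre i hi

theorem sweep_spec {κ : ℕ → ℝ} {p q : ℕ → ℕ} {r : ℕ} (hsize : s.wreg WordReg.size = n)
    (hone : s.wreg WordReg.one = 1) (hrow : s.wreg WordReg.row = r)
    (hs : ∀ u < n, s.rmem RealArray.keys u = κ u ∧ s.wmem WordArray.list u = u ∧
      s.wmem WordArray.later u = p u ∧ s.wmem WordArray.earlier u = q u)
    (habove : s.wreg WordReg.above = ∑ u ∈ Finset.range n, p u)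
    (hbelow : s.wreg WordReg.below = ∑ u ∈ Finset.range n, q u)
    (hp : ∀ u < n, p u ≤ 1) (hq : ∀ u < n, q u ≤ 1) (h1W : 1 < W) (hnW : 2 * n < W)
    (hW : r + n < W) :
    WP W sweep (fun t s' => t ≤ Nat.clog 2 n * (n * 28 + 6) + n * 12 + 4 ∧
      (∀ w < n, (∀ u < n, u ≠ w → κ u = κ w → p u = 0 ∧ q u = 0) →
        s'.wmem WordArray.above (r + w) = sideCount κ p q n w ∧
        s'.wmem WordArray.below (r + w) = sideCount κ q p n w) ∧
      ∀ i < r, s'.wmem WordArray.above i = s.wmem WordArray.above i ∧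
        s'.wmem WordArray.below i = s.wmem WordArray.below i) s := by
  have hid : slice (s.wmem WordArray.list) 0 n = List.range n := by
    rw [slice_congr (g := id) fun k _ hk => (hs k hk).2.1]
    simp [slice, List.range_eq_range']
  refine .seq ((mergeSort_spec hsize hone h1W hnW (.of_eq hid)).frame.mono ?_)
  rintro t s₁ ⟨⟨ht, hA, hsort⟩, hf⟩
  refine .seq (.block (by simp; lia) ?_)
  refine (sweepLoop_spec (s := blockEffect [.wconst WordReg.other 0] s₁)
    (A := s₁.wmem WordArray.list)
    ((hf.wreg WordReg.size rfl).trans hsize) ((hf.wreg WordReg.one rfl).trans hone) rfl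
    ((hf.wreg WordReg.row rfl).trans hrow) rfl hA
    (fun u hu => hf.wmem WordArray.later rfl ▸ (hs u hu).2.2.1)
    (fun u hu => hf.wmem WordArray.earlier rfl ▸ (hs u hu).2.2.2)
    ((hf.wreg WordReg.above rfl).trans habove) ((hf.wreg WordReg.below rfl).trans hbelow)
    hp hq hW).mono ?_
  rintro t' s' ⟨ht', hcount, hpre⟩
  refine ⟨by simp only [List.length]; lia, fun w hw htie => ?_, fun i hi => ?_⟩
  · obtain ⟨k, hk, rfl⟩ := (bijOn_of_slice_perm_range hA).surjOn (by simpa using hw)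
    have hk : k < n := by simpa using hk
    have hsort' (i j : ℕ) (hij : i < j) (hj : j < n) :
        κ (s₁.wmem WordArray.list i) ≤ κ (s₁.wmem WordArray.list j) := by
      rw [← (hs _ (lt_of_slice_perm_range hA hj)).1,
        ← (hs _ (lt_of_slice_perm_range hA (hij.trans hj))).1]
      exact hsort i j hij hj
    rw [(hcount k hk).1, (hcount k hk).2, sweepRest_eq_sideCount hA hsort' hk htie,
      sweepRest_eq_sideCount hA hsort' hk fun u hu hne hκ => (htie u hu hne hκ).symm]
    exact ⟨rfl, rfl⟩
  · simpa [← hf.wmem WordArray.above rfl, ← hf.wmem WordArray.below rfl] using hpre i hi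

theorem addExcess_spec {b c S : ℕ} (hone : s.wreg WordReg.one = 1)
    (habove : s.wreg WordReg.above = b) (hbelow : s.wreg WordReg.below = c)
    (hexcess : s.wreg WordReg.excess = S) (hbc : b + c ≤ n) (hW : S + n * n < W) :
    WP W addExcess (fun t s' => t ≤ 4 ∧
      s'.wreg WordReg.excess = S + (b + c) * (b + c - 1)) s := by
  have hmul : (b + c) * (b + c - 1) ≤ n * n := Nat.mul_le_mul hbc ((Nat.sub_le _ _).trans hbc)
  have hn : n ≤ n * n := Nat.le_mul_self n
  refine .block ?_ ⟨by simp, by simp [*]⟩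
  simp [*]
  lia

theorem vertexPhase_spec {S : ℕ} (hs : Encodes n a P s) (hv : s.wreg WordReg.center = v)
    (hvn : v < n) (hS : s.wreg WordReg.excess = S) (ha : ∀ u < n, a v u ≤ 1)
    (htie : ∀ w < n, w ≠ v → ∀ u < n, u ≠ w → slopeKey (P v) (P u) = slopeKey (P v) (P w) →
      a v u = 0)
    (hW : S + n * n + 2 * n + 1 < W) :
    WP W vertexPhase (fun t s' => t ≤ Nat.clog 2 n * (n * 28 + 6) + n * 39 + 13 ∧
      s'.wreg WordReg.excess = S + (∑ u ∈ Finset.range n, a v u) *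
        (∑ u ∈ Finset.range n, a v u - 1) ∧
      (∀ w < n, w ≠ v → s'.wmem WordArray.above (v * n + w) = nbrsAbove n a P v w ∧
        s'.wmem WordArray.below (v * n + w) = nbrsBelow n a P v w) ∧
      ∀ i < v * n, s'.wmem WordArray.above i = s.wmem WordArray.above i ∧
        s'.wmem WordArray.below i = s.wmem WordArray.below i) s := by
  have hsum : ∑ u ∈ Finset.range n, later a P v u + ∑ u ∈ Finset.range n, earlier a P v u =
      ∑ u ∈ Finset.range n, a v u := by
    simp only [← Finset.sum_add_distrib, later_add_earlier]
  have hrow : v * n + n ≤ n * n := Nat.succ_mul v n ▸ Nat.mul_le_mul_right n hvn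
  have hnn : n ≤ n * n := Nat.le_mul_self n
  refine .seq (.block (by simp [hs.size, hv]; lia) ?_)
  generalize hs₁ : blockEffect _ s = s₁
  have hrow₁ : s₁.wreg WordReg.row = v * n := by simp [← hs₁, hv, hs.size]
  have hE₁ : Encodes n a P s₁ := by
    obtain ⟨hsize, hone, hadj, hfst, hsnd⟩ := hs
    exact ⟨by simp [← hs₁, hsize], by simp [← hs₁, hone], by simpa [← hs₁] using hadj,
      by simpa [← hs₁] using hfst, by simpa [← hs₁] using hsnd⟩
  refine .seq ((addOtherLoop_spec hE₁ (by simp [← hs₁, hv]) (by simp [← hs₁]) hrow₁ hvn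
    (by simp [← hs₁]) (by simp [← hs₁]) ha (by lia)).frame.mono ?_)
  rintro t₂ s₂ ⟨⟨ht₂, hs₂, habove, hbelow⟩, hf₂⟩
  have hE₂ := hE₁.frame hf₂ rfl
  refine .seq ((addExcess_spec hE₂.one habove hbelow (S := S)
    (by rw [hf₂.wreg _ rfl]; simp [← hs₁, hS]) (hsum ▸ sum_le_of_le_one ha)
    (by lia)).frame.mono ?_)
  rintro t₃ s₃ ⟨⟨ht₃, hexcess⟩, hf₃⟩
  have hE₃ := hE₂.frame hf₃ rfl
  refine (sweep_spec (κ := fun u => slopeKey (P v) (P u)) hE₃.size hE₃.one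
    ((hf₃.wreg WordReg.row rfl).trans ((hf₂.wreg _ rfl).trans hrow₁))
    (by simpa only [hf₃.rmem _ rfl, hf₃.wmem _ rfl] using hs₂)
    ((hf₃.wreg _ rfl).trans habove) ((hf₃.wreg _ rfl).trans hbelow)
    (fun u hu => later_le (ha u hu)) (fun u hu => earlier_le (ha u hu)) (by lia) (by lia)
    (by lia)).frame.mono ?_
  rintro t₄ s₄ ⟨⟨ht₄, hcount, hpre⟩, hf₄⟩
  refine ⟨by simp only [List.length]; lia, ?_, fun w hw hwv => ?_, fun i hi => ?_⟩
  · rw [hf₄.wreg _ rfl, hexcess, hsum]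
  · refine hcount w hw fun u hu hne hκ => ?_
    simpa [htie w hw hwv u hu hne hκ] using later_add_earlier a P v u
  · rw [(hpre i hi).1, (hpre i hi).2, hf₃.wmem _ rfl, hf₃.wmem _ rfl, hf₂.wmem _ rfl,
      hf₂.wmem _ rfl]
    simp [← hs₁]

namespace WordReg

@[simp] abbrev index' : ℕ := 24
@[simp] abbrev above' : ℕ := 25
@[simp] abbrev below' : ℕ := 26
@[simp] abbrev same : ℕ := 27
@[simp] abbrev opposite : ℕ := 28
@[simp] abbrev eight : ℕ := 29

end WordReg

/-- Add the numbers of pairs of edges at `center` and `other` that lie on the same side and on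
opposite sides of the line through the two points to `same` and `opposite`. -/
def addPairs : Program :=
  .ifThenElse (.weq WordReg.center WordReg.other) .skip
    (block [.wop .mul WordReg.index WordReg.center WordReg.size,
      .wop .add WordReg.index WordReg.index WordReg.other,
      .wload WordReg.above WordArray.above WordReg.index,
      .wload WordReg.below WordArray.below WordReg.index,
      .wop .mul WordReg.index' WordReg.other WordReg.size,
      .wop .add WordReg.index' WordReg.index' WordReg.center,
      .wload WordReg.above' WordArray.above WordReg.index',
      .wload WordReg.below' WordArray.below WordReg.index',
      .wop .mul WordReg.product WordReg.above WordReg.above',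
      .wop .add WordReg.same WordReg.same WordReg.product,
      .wop .mul WordReg.product WordReg.below WordReg.below',
      .wop .add WordReg.same WordReg.same WordReg.product,
      .wop .mul WordReg.product WordReg.above WordReg.below',
      .wop .add WordReg.opposite WordReg.opposite WordReg.product,
      .wop .mul WordReg.product WordReg.below WordReg.above',
      .wop .add WordReg.opposite WordReg.opposite WordReg.product])

/-- Execute `addPairs` for all vertices `other`. -/
def addPairsAt : Program :=
  .seq (block [.wconst WordReg.other 0])
    (forLoop WordReg.other WordReg.size WordReg.one addPairs)

/-- Compute the number of crossings in word register `0`. -/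
def countCrossings : Program :=
  .seq (block [.wconst WordReg.one 1])
    (.seq (forLoop WordReg.center WordReg.size WordReg.one vertexPhase)
      (.seq (block [.wconst WordReg.center 0])
        (.seq (forLoop WordReg.center WordReg.size WordReg.one addPairsAt)
          (block [.wop .sub WordReg.size WordReg.same WordReg.opposite,
            .wop .sub WordReg.size WordReg.size WordReg.excess, .wconst WordReg.eight 8,
            .wop .div WordReg.size WordReg.size WordReg.eight]))))

/-- An upper bound for the running time of `countCrossings`. -/
def timeBound (n : ℕ) : ℕ :=
  n * (Nat.clog 2 n * (n * 28 + 6) + n * 39 + 15) + n * (n * 19 + 4) + 8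

variable {f g : ℕ → ℕ → ℕ} {w S T : ℕ}

/-- The number of pairs of edges at `v` and `w` on the same side of the line through `v` and `w`,
if there are `f v w` and `g v w` edges at `v` on the two sides. -/
def samePairs (f g : ℕ → ℕ → ℕ) (v w : ℕ) : ℕ :=
  if v = w then 0 else f v w * f w v + g v w * g w v

/-- The number of pairs of edges at `v` and `w` on opposite sides of the line through `v` and `w`,
if there are `f v w` and `g v w` edges at `v` on the two sides. -/
def oppositePairs (f g : ℕ → ℕ → ℕ) (v w : ℕ) : ℕ :=
  if v = w then 0 else f v w * g w v + g v w * f w v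

/-- The state holds the numbers `f v w` and `g v w` of edges on the two sides of the line through
`v` and `w`, for the first `m` vertices `v`. -/
structure StoresCounts (n m : ℕ) (f g : ℕ → ℕ → ℕ) (s : State) : Prop where
  above : ∀ v < m, ∀ w < n, w ≠ v → s.wmem WordArray.above (v * n + w) = f v w
  below : ∀ v < m, ∀ w < n, w ≠ v → s.wmem WordArray.below (v * n + w) = g v w

theorem nbrsAbove_le (w : ℕ) (ha : ∀ u < n, a v u ≤ 1) : nbrsAbove n a P v w ≤ n :=
  sideCount_le w (fun u hu => later_le (ha u hu)) fun u hu => earlier_le (ha u hu)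

theorem nbrsBelow_le (w : ℕ) (ha : ∀ u < n, a v u ≤ 1) : nbrsBelow n a P v w ≤ n :=
  sideCount_le w (fun u hu => earlier_le (ha u hu)) fun u hu => later_le (ha u hu)

theorem mul_add_le_mul {k : ℕ} (hk : k < n) (B : ℕ) : k * B + B ≤ n * B :=
  Nat.succ_mul k B ▸ Nat.mul_le_mul_right B hk

theorem sum_range_le_mul {h : ℕ → ℕ} {k B : ℕ} (hB : ∀ j < k, h j ≤ B) :
    ∑ j ∈ Finset.range k, h j ≤ k * B := by
  simpa using Finset.sum_le_card_nsmul (Finset.range k) h B fun j hj => hB j (Finset.mem_range.1 hj)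

theorem samePairs_le (hf : ∀ v < n, ∀ w < n, f v w ≤ n) (hg : ∀ v < n, ∀ w < n, g v w ≤ n)
    (hv : v < n) (hw : w < n) : samePairs f g v w ≤ 2 * (n * n) := by
  rw [samePairs, two_mul]
  split_ifs
  · exact Nat.zero_le _
  · exact add_le_add (Nat.mul_le_mul (hf v hv w hw) (hf w hw v hv))
      (Nat.mul_le_mul (hg v hv w hw) (hg w hw v hv))

theorem oppositePairs_le (hf : ∀ v < n, ∀ w < n, f v w ≤ n) (hg : ∀ v < n, ∀ w < n, g v w ≤ n)
    (hv : v < n) (hw : w < n) : oppositePairs f g v w ≤ 2 * (n * n) := by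
  rw [oppositePairs, two_mul]
  split_ifs
  · exact Nat.zero_le _
  · exact add_le_add (Nat.mul_le_mul (hf v hv w hw) (hg w hw v hv))
      (Nat.mul_le_mul (hg v hv w hw) (hf w hw v hv))

theorem addPairs_spec (hsize : s.wreg WordReg.size = n) (hcenter : s.wreg WordReg.center = v)
    (hother : s.wreg WordReg.other = w) (hv : v < n) (hw : w < n)
    (hsame : s.wreg WordReg.same = S) (hopposite : s.wreg WordReg.opposite = T)
    (hs : StoresCounts n n f g s) (hf : ∀ v < n, ∀ w < n, f v w ≤ n)
    (hg : ∀ v < n, ∀ w < n, g v w ≤ n) (hS : S + 2 * (n * n) < W) (hT : T + 2 * (n * n) < W) :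
    WP W addPairs (fun t s' => t ≤ 17 ∧ s'.wreg WordReg.same = S + samePairs f g v w ∧
      s'.wreg WordReg.opposite = T + oppositePairs f g v w) s := by
  refine .ifThenElse (fun h => ⟨0, s, .skip s, ?_⟩) fun h => ?_ <;>
    simp only [Test.Holds, hcenter, hother] at h
  · simp [samePairs, oppositePairs, h, hsame, hopposite]
  have hindex := mul_add_lt_mul hv hw
  have hindex' := mul_add_lt_mul hw hv
  have habove := hs.above v hv w hw (Ne.symm h)
  have hbelow := hs.below v hv w hw (Ne.symm h)
  have habove' := hs.above w hw v hv h
  have hbelow' := hs.below w hw v hv h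
  have hle := samePairs_le hf hg hv hw
  have hle' := oppositePairs_le hf hg hv hw
  have hnn : n ≤ n * n := Nat.le_mul_self n
  rw [samePairs, if_neg h] at hle ⊢
  rw [oppositePairs, if_neg h] at hle' ⊢
  have := hf v hv w hw
  have := hg v hv w hw
  have := hf w hw v hv
  have := hg w hw v hv
  clear hs hf hg
  refine .block ?_ ⟨by simp, by simp [*, add_assoc], by simp [*, add_assoc]⟩
  simp [*]
  omega

theorem StoresCounts.congr {m : ℕ} {s' : State} (h : StoresCounts n m f g s)
    (habove : s'.wmem WordArray.above = s.wmem WordArray.above)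
    (hbelow : s'.wmem WordArray.below = s.wmem WordArray.below) : StoresCounts n m f g s' :=
  ⟨habove ▸ h.above, hbelow ▸ h.below⟩

theorem addPairsAt_spec (hsize : s.wreg WordReg.size = n) (hone : s.wreg WordReg.one = 1)
    (hcenter : s.wreg WordReg.center = v) (hv : v < n) (hsame : s.wreg WordReg.same = S)
    (hopposite : s.wreg WordReg.opposite = T) (hs : StoresCounts n n f g s)
    (hf : ∀ v < n, ∀ w < n, f v w ≤ n) (hg : ∀ v < n, ∀ w < n, g v w ≤ n)
    (hS : S + n * (2 * (n * n)) < W) (hT : T + n * (2 * (n * n)) < W) (hnW : n < W) :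
    WP W addPairsAt (fun t s' => t ≤ n * 19 + 2 ∧
      s'.wreg WordReg.same = S + ∑ w ∈ Finset.range n, samePairs f g v w ∧
      s'.wreg WordReg.opposite = T + ∑ w ∈ Finset.range n, oppositePairs f g v w) s := by
  have hpartial {h : ℕ → ℕ} {k : ℕ} (hk : k < n) (hh : ∀ w < n, h w ≤ 2 * (n * n)) :
      ∑ w ∈ Finset.range k, h w + 2 * (n * n) ≤ n * (2 * (n * n)) :=
    (Nat.add_le_add_right (sum_range_le_mul fun w hw => hh w (hw.trans hk)) _).trans
      (mul_add_le_mul hk _)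
  refine .seq (.block (by simp; lia) ?_)
  refine (WP.forLoop (N := n) (C := 17) (fun k s' =>
    s'.wreg WordReg.same = S + ∑ w ∈ Finset.range k, samePairs f g v w ∧
    s'.wreg WordReg.opposite = T + ∑ w ∈ Finset.range k, oppositePairs f g v w) (by simp)
    (by simpa using hsize) (by simpa using hone) rfl rfl rfl (by simp) (by simp) hnW
    (by simp [hsame, hopposite]) fun k s' hk hfr hi ⟨hsame', hopposite'⟩ => ?_).mono
    fun t s' ⟨_, hI, _, ht⟩ => ⟨(Nat.add_le_add_left ht 1).trans (by lia), hI⟩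
  have hle := hpartial hk fun w hw => samePairs_le hf hg hv hw
  have hle' := hpartial hk fun w hw => oppositePairs_le hf hg hv hw
  refine (addPairs_spec (by simpa [hsize] using hfr.wreg WordReg.size rfl)
    (by simpa [hcenter] using hfr.wreg WordReg.center rfl) hi hv hk hsame' hopposite'
    (hs.congr (by simpa using hfr.wmem WordArray.above rfl)
      (by simpa using hfr.wmem WordArray.below rfl)) hf hg (by lia) (by lia)).mono ?_
  rintro t s'' ⟨ht, hsame'', hopposite''⟩
  exact ⟨ht, by simp [hsame'', Finset.sum_range_succ, add_assoc],
    by simp [hopposite'', Finset.sum_range_succ, add_assoc]⟩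

theorem addPairsLoop_spec (hsize : s.wreg WordReg.size = n) (hone : s.wreg WordReg.one = 1)
    (hcenter : s.wreg WordReg.center = 0) (hsame : s.wreg WordReg.same = 0)
    (hopposite : s.wreg WordReg.opposite = 0) (hs : StoresCounts n n f g s)
    (hf : ∀ v < n, ∀ w < n, f v w ≤ n) (hg : ∀ v < n, ∀ w < n, g v w ≤ n)
    (hW : n * (n * (2 * (n * n))) + n < W) :
    WP W (forLoop WordReg.center WordReg.size WordReg.one addPairsAt) (fun t s' =>
      t ≤ n * (n * 19 + 4) + 1 ∧
      s'.wreg WordReg.same = ∑ v ∈ Finset.range n, ∑ w ∈ Finset.range n, samePairs f g v w ∧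
      s'.wreg WordReg.opposite =
        ∑ v ∈ Finset.range n, ∑ w ∈ Finset.range n, oppositePairs f g v w) s := by
  have hpartial {h : ℕ → ℕ → ℕ} {k : ℕ} (hk : k < n)
      (hh : ∀ v < n, ∀ w < n, h v w ≤ 2 * (n * n)) :
      ∑ v ∈ Finset.range k, ∑ w ∈ Finset.range n, h v w + n * (2 * (n * n)) ≤
        n * (n * (2 * (n * n))) :=
    (Nat.add_le_add_right (sum_range_le_mul fun v hv =>
      sum_range_le_mul (hh v (hv.trans hk))) _).trans (mul_add_le_mul hk _)
  refine (WP.forLoop (N := n) (C := n * 19 + 2) (fun k s' =>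
    s'.wreg WordReg.same = ∑ v ∈ Finset.range k, ∑ w ∈ Finset.range n, samePairs f g v w ∧
    s'.wreg WordReg.opposite =
      ∑ v ∈ Finset.range k, ∑ w ∈ Finset.range n, oppositePairs f g v w) hcenter hsize hone
    rfl rfl rfl (by simp) (by simp) (by lia) (by simp [hsame, hopposite])
    fun k s' hk hfr hi ⟨hsame', hopposite'⟩ => ?_).mono fun t s' ⟨_, hI, _, ht⟩ => ⟨ht, hI⟩
  have hle := hpartial hk fun v hv w hw => samePairs_le hf hg hv hw
  have hle' := hpartial hk fun v hv w hw => oppositePairs_le hf hg hv hw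
  refine (addPairsAt_spec ((hfr.wreg _ rfl).trans hsize) ((hfr.wreg _ rfl).trans hone) hi hk hsame'
    hopposite' (hs.congr (hfr.wmem _ rfl) (hfr.wmem _ rfl)) hf hg (by lia) (by lia)
    (by lia)).mono ?_
  rintro t s'' ⟨ht, hsame'', hopposite''⟩
  exact ⟨ht, by simp [hsame'', Finset.sum_range_succ],
    by simp [hopposite'', Finset.sum_range_succ]⟩

theorem vertexPhaseLoop_spec (hs : Encodes n a P s) (hcenter : s.wreg WordReg.center = 0)
    (hexcess : s.wreg WordReg.excess = 0) (ha : ∀ v < n, ∀ u < n, a v u ≤ 1)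
    (htie : ∀ v < n, ∀ w < n, w ≠ v → ∀ u < n, u ≠ w →
      slopeKey (P v) (P u) = slopeKey (P v) (P w) → a v u = 0)
    (hW : n * (n * n) + 2 * n + 1 < W) :
    WP W (forLoop WordReg.center WordReg.size WordReg.one vertexPhase) (fun t s' =>
      t ≤ n * (Nat.clog 2 n * (n * 28 + 6) + n * 39 + 15) + 1 ∧
      s'.wreg WordReg.excess = ∑ v ∈ Finset.range n,
        (∑ u ∈ Finset.range n, a v u) * (∑ u ∈ Finset.range n, a v u - 1) ∧
      StoresCounts n n (nbrsAbove n a P) (nbrsBelow n a P) s') s := by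
  have hdegree {v : ℕ} (hv : v < n) :
      (∑ u ∈ Finset.range n, a v u) * (∑ u ∈ Finset.range n, a v u - 1) ≤ n * n :=
    have h := sum_le_of_le_one (ha v hv)
    Nat.mul_le_mul h ((Nat.sub_le _ _).trans h)
  refine (WP.forLoop (N := n) (C := Nat.clog 2 n * (n * 28 + 6) + n * 39 + 13) (fun k s' =>
    s'.wreg WordReg.excess = ∑ v ∈ Finset.range k,
      (∑ u ∈ Finset.range n, a v u) * (∑ u ∈ Finset.range n, a v u - 1) ∧
    StoresCounts n k (nbrsAbove n a P) (nbrsBelow n a P) s') hcenter hs.size hs.one rfl rfl rfl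
    (by simp) (by simp) (by lia) ⟨by simpa using hexcess, by simp, by simp⟩
    fun k s' hk hf hi ⟨hexcess', hcounts⟩ => ?_).mono fun t s' ⟨_, hI, _, ht⟩ => ⟨ht, hI⟩
  have hpartial := (Nat.add_le_add_right
    (sum_range_le_mul fun v hv => hdegree (hv.trans hk)) _).trans (mul_add_le_mul hk (n * n))
  refine (vertexPhase_spec (hs.frame hf rfl) hi hk hexcess' (ha k hk) (htie k hk)
    (by lia)).mono ?_
  rintro t s'' ⟨ht, hexcess'', hnew, hold⟩
  have hlt {v w : ℕ} (hv : v < k) (hw : w < n) : v * n + w < k * n :=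
    (Nat.add_lt_add_left hw _).trans_le (mul_add_le_mul hv n)
  refine ⟨ht, by simp [hexcess'', Finset.sum_range_succ], fun v hv w hw hwv => ?_,
    fun v hv w hw hwv => ?_⟩ <;> rcases Nat.lt_succ_iff_lt_or_eq.1 hv with hv | rfl
  · exact (hold _ (hlt hv hw)).1.trans (hcounts.above v hv w hw hwv)
  · exact (hnew w hw hwv).1
  · exact (hold _ (hlt hv hw)).2.trans (hcounts.below v hv w hw hwv)
  · exact (hnew w hw hwv).2

theorem countCrossings_spec (hsize : s.wreg WordReg.size = n)
    (hzero : ∀ i ≠ WordReg.size, s.wreg i = 0)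
    (hadj : ∀ v < n, ∀ u < n, s.wmem WordArray.adjacency (v * n + u) = a v u)
    (hfst : ∀ v < n, s.rmem RealArray.fst v = (P v).1)
    (hsnd : ∀ v < n, s.rmem RealArray.snd v = (P v).2) (ha : ∀ v < n, ∀ u < n, a v u ≤ 1)
    (htie : ∀ v < n, ∀ w < n, w ≠ v → ∀ u < n, u ≠ w →
      slopeKey (P v) (P u) = slopeKey (P v) (P w) → a v u = 0)
    (hW : n * (n * (2 * (n * n))) + n * (n * n) + 2 * n + 8 < W) :
    WP W countCrossings (fun t s' => t ≤ timeBound n ∧ s'.wreg 0 =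
      (∑ v ∈ Finset.range n, ∑ w ∈ Finset.range n,
          samePairs (nbrsAbove n a P) (nbrsBelow n a P) v w -
        ∑ v ∈ Finset.range n, ∑ w ∈ Finset.range n,
          oppositePairs (nbrsAbove n a P) (nbrsBelow n a P) v w -
        ∑ v ∈ Finset.range n,
          (∑ u ∈ Finset.range n, a v u) * (∑ u ∈ Finset.range n, a v u - 1)) / 8) s := by
  have habove (v : ℕ) (hv : v < n) (w : ℕ) (_ : w < n) : nbrsAbove n a P v w ≤ n :=
    nbrsAbove_le w (ha v hv)
  have hbelow (v : ℕ) (hv : v < n) (w : ℕ) (_ : w < n) : nbrsBelow n a P v w ≤ n :=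
    nbrsBelow_le w (ha v hv)
  refine .seq (.block (by simp; lia) ?_)
  generalize hs₁ : blockEffect _ s = s₁
  have hE : Encodes n a P s₁ := ⟨by simp [← hs₁, hsize], by simp [← hs₁], by simpa [← hs₁],
    by simpa [← hs₁], by simpa [← hs₁]⟩
  have hzero' (i : ℕ) (hi : i ≠ WordReg.size) (hi' : i ≠ WordReg.one) : s₁.wreg i = 0 := by
    simpa [← hs₁, hi'] using hzero i hi
  refine .seq ((vertexPhaseLoop_spec hE (hzero' _ (by simp) (by simp))
    (hzero' _ (by simp) (by simp)) ha htie (by lia)).frame.mono ?_)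
  rintro t₂ s₂ ⟨⟨ht₂, hexcess, hcounts⟩, hf₂⟩
  refine .seq (.block (by simp; lia) (.seq ((addPairsLoop_spec
    (s := blockEffect [.wconst WordReg.center 0] s₂)
    ((hf₂.wreg WordReg.size rfl).trans hE.size) ((hf₂.wreg WordReg.one rfl).trans hE.one)
    (by simp) ((hf₂.wreg WordReg.same rfl).trans (hzero' _ (by simp) (by simp)))
    ((hf₂.wreg WordReg.opposite rfl).trans (hzero' _ (by simp) (by simp)))
    (hcounts.congr rfl rfl) habove hbelow (by lia)).frame.mono ?_)))
  rintro t₃ s₃ ⟨⟨ht₃, hsame, hopposite⟩, hf₃⟩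
  have hexcess' := (hf₃.wreg WordReg.excess rfl).trans hexcess
  have hle : s₃.wreg WordReg.same ≤ n * (n * (2 * (n * n))) := hsame ▸
    sum_range_le_mul fun v hv => sum_range_le_mul fun w hw => samePairs_le habove hbelow hv hw
  refine .block (by simp; lia) ⟨?_, by simp [← hsame, ← hopposite, ← hexcess']⟩
  simp only [List.length, timeBound]
  lia

end RealRAM

namespace GeometricGraph

variable {n : ℕ} (G : GeometricGraph n) [DecidableRel G.graph.Adj]

/-- The number of neighbours of `v` to the left of the line from `v` to `w`, minus the number of
those to the right. -/
noncomputable def signedDegree (v w : Fin n) : ℤ :=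
  ∑ u, if G.graph.Adj v u then G.orientSign v w u else 0

theorem signedDegree_mul_signedDegree (v w : Fin n) :
    G.signedDegree v w * G.signedDegree w v = -∑ u, if G.graph.Adj v u then
      ∑ x, if G.graph.Adj w x then G.sideProduct v u w x else 0 else 0 := by
  simp only [signedDegree, sideProduct, G.orientSign_swap_left v w, Finset.sum_mul,
    ← Finset.sum_neg_distrib]
  refine Finset.sum_congr rfl fun u _ => ?_
  split_ifs
  · simp only [Finset.mul_sum, ← Finset.sum_neg_distrib]
    exact Finset.sum_congr rfl fun x _ => by split_ifs <;> ring
  · simp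

theorem sum_signedDegree_mul_signedDegree :
    ∑ v, ∑ w, G.signedDegree v w * G.signedDegree w v =
      -(8 * G.crossings + ∑ v, (G.graph.degree v : ℤ) * (G.graph.degree v - 1)) := by
  rw [← sum_dart_sideProduct]
  simp only [signedDegree_mul_signedDegree, Finset.sum_neg_distrib]
  rw [sum_dart_eq_sum_ite G.graph fun v u => ∑ d : G.graph.Dart, G.sideProduct v u d.fst d.snd]
  congr 1
  refine Finset.sum_congr rfl fun v _ => ?_
  rw [Finset.sum_comm]
  refine Finset.sum_congr rfl fun u _ => ?_
  rw [sum_dart_eq_sum_ite G.graph (G.sideProduct v u)]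
  split_ifs <;> simp

end GeometricGraph

theorem sideCount_sub_sideCount (κ : ℕ → ℝ) (p q : ℕ → ℕ) (n w : ℕ) :
    (sideCount κ p q n w : ℤ) - sideCount κ q p n w =
      ∑ u ∈ (Finset.range n).erase w, (if κ w < κ u then 1 else -1) * ((p u : ℤ) - q u) := by
  simp only [sideCount, Nat.cast_sum, ← Finset.sum_sub_distrib]
  refine Finset.sum_congr rfl fun u _ => ?_
  split_ifs <;> ring

namespace RealRAM

theorem later_sub_earlier (a : ℕ → ℕ → ℕ) (P : ℕ → ℝ × ℝ) (v u : ℕ) :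
    (later a P v u : ℤ) - earlier a P v u = lexSign (P v) (P u) * a v u := by
  rw [later, earlier, lexSign]
  split_ifs <;> simp

variable {n : ℕ} (G : GeometricGraph n)

/-- The entries of the adjacency matrix in the input. -/
noncomputable def inputAdj (v u : ℕ) : ℕ := (input G).wmem WordArray.adjacency (v * n + u)

/-- The points in the input. -/
noncomputable def inputPoint (v : ℕ) : ℝ × ℝ :=
  ((input G).rmem RealArray.fst v, (input G).rmem RealArray.snd v)

theorem inputAdj_le_one (v u : ℕ) : inputAdj G v u ≤ 1 := by
  unfold inputAdj input
  dsimp only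
  split_ifs <;> simp

theorem inputAdj_val [DecidableRel G.graph.Adj] (v u : Fin n) :
    inputAdj G v u = if G.graph.Adj v u then 1 else 0 := by
  unfold inputAdj input
  dsimp only
  congr 1
  refine propext ⟨?_, fun h => ⟨rfl, v, u, rfl, h⟩⟩
  rintro ⟨-, i, j, hij, h⟩
  have hpair : finProdFinEquiv (v, u) = finProdFinEquiv (i, j) := Fin.ext <| by
    simpa [mul_comm n, add_comm] using hij
  obtain ⟨rfl, rfl⟩ := Prod.mk.inj (finProdFinEquiv.injective hpair)
  exact h

theorem inputPoint_val (v : Fin n) : inputPoint G v = (G.point v 0, G.point v 1) := by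
  simp [inputPoint, input]

theorem inputPoint_ne {v u : Fin n} (h : v ≠ u) : inputPoint G v ≠ inputPoint G u := by
  intro heq
  simp only [inputPoint_val, Prod.mk.injEq] at heq
  refine h (G.point_injective (PiLp.ext fun i => ?_))
  fin_cases i
  exacts [heq.1, heq.2]

theorem inputAdj_eq_zero_of_slopeKey_eq {v w u : Fin n} (hw : v ≠ w) (hwu : w ≠ u)
    (h : slopeKey (inputPoint G v) (inputPoint G u) =
      slopeKey (inputPoint G v) (inputPoint G w)) : inputAdj G v u = 0 := by
  classical
  rcases eq_or_ne v u with rfl | hu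
  · simp [inputAdj_val]
  · refine absurd h.symm (slopeKey_ne_slopeKey (inputPoint_ne G hw) (inputPoint_ne G hu) ?_)
    simpa only [inputPoint_val, orient] using G.orient_point_ne_zero hw hu hwu

theorem nbrsAbove_sub_nbrsBelow [DecidableRel G.graph.Adj] {v w : Fin n} (hw : v ≠ w) :
    (nbrsAbove n (inputAdj G) (inputPoint G) v w : ℤ) -
      nbrsBelow n (inputAdj G) (inputPoint G) v w =
    lexSign (inputPoint G v) (inputPoint G w) * G.signedDegree v w := by
  rw [nbrsAbove, nbrsBelow, sideCount_sub_sideCount, GeometricGraph.signedDegree, Finset.mul_sum,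
    ← Finset.filter_ne', Finset.sum_filter, Finset.sum_range]
  refine Finset.sum_congr rfl fun u _ => ?_
  rw [later_sub_earlier, inputAdj_val]
  by_cases hadj : G.graph.Adj v u
  · rcases eq_or_ne w u with rfl | hwu
    · simp
    have hside := ite_slopeKey_lt_slopeKey (inputPoint_ne G hw) (inputPoint_ne G hadj.ne)
      (by simpa only [inputPoint_val, orient] using G.orient_point_ne_zero hw hadj.ne hwu)
    rw [if_pos (Fin.val_injective.ne hwu.symm), if_pos hadj, if_pos hadj, hside]
    simp only [GeometricGraph.orientSign, orient, inputPoint_val]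
    rcases lexSign_eq_one_or_neg_one (G.point v 0, G.point v 1) (G.point u 0, G.point u 1)
      with h | h <;> simp [h]
  · simp [hadj]

theorem samePairs_sub_oppositePairs [DecidableRel G.graph.Adj] (v w : Fin n) :
    (samePairs (nbrsAbove n (inputAdj G) (inputPoint G)) (nbrsBelow n (inputAdj G) (inputPoint G))
        v w : ℤ) -
      oppositePairs (nbrsAbove n (inputAdj G) (inputPoint G))
        (nbrsBelow n (inputAdj G) (inputPoint G)) v w =
    -(G.signedDegree v w * G.signedDegree w v) := by
  rcases eq_or_ne v w with rfl | h
  · simp [samePairs, oppositePairs, GeometricGraph.signedDegree]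
  · rw [samePairs, oppositePairs, if_neg (Fin.val_injective.ne h), if_neg (Fin.val_injective.ne h)]
    have hvw := nbrsAbove_sub_nbrsBelow G h
    have hwv := nbrsAbove_sub_nbrsBelow G h.symm
    have hsign := lexSign_mul_lexSign_swap (inputPoint_ne G h)
    push_cast
    linear_combination (nbrsAbove n (inputAdj G) (inputPoint G) w v -
      nbrsBelow n (inputAdj G) (inputPoint G) w v : ℤ) * hvw +
      lexSign (inputPoint G v) (inputPoint G w) * G.signedDegree v w * hwv +
      G.signedDegree v w * G.signedDegree w v * hsign

theorem sum_inputAdj [DecidableRel G.graph.Adj] (v : Fin n) :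
    ∑ u : Fin n, inputAdj G v u = G.graph.degree v := by
  simp [inputAdj_val, ← G.graph.card_neighborFinset_eq_degree, G.graph.neighborFinset_eq_filter]

theorem sum_samePairs :
    ∑ v ∈ Finset.range n, ∑ w ∈ Finset.range n,
        samePairs (nbrsAbove n (inputAdj G) (inputPoint G))
          (nbrsBelow n (inputAdj G) (inputPoint G)) v w =
      ∑ v ∈ Finset.range n, ∑ w ∈ Finset.range n,
        oppositePairs (nbrsAbove n (inputAdj G) (inputPoint G))
          (nbrsBelow n (inputAdj G) (inputPoint G)) v w +
      (∑ v ∈ Finset.range n, (∑ u ∈ Finset.range n, inputAdj G v u) *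
        (∑ u ∈ Finset.range n, inputAdj G v u - 1) + 8 * G.crossings) := by
  classical
  have cast_mul_pred (d : ℕ) : ((d * (d - 1) : ℕ) : ℤ) = d * (d - 1) := by cases d <;> simp
  have hsub (v w : Fin n) := eq_add_of_sub_eq (samePairs_sub_oppositePairs G v w)
  rw [← Nat.cast_inj (R := ℤ), Finset.sum_range, Finset.sum_range, Finset.sum_range]
  simp only [Finset.sum_range, sum_inputAdj, Nat.cast_add, Nat.cast_sum, cast_mul_pred, hsub,
    Finset.sum_add_distrib, Finset.sum_neg_distrib, G.sum_signedDegree_mul_signedDegree]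
  push_cast
  ring

theorem timeBound_le {n : ℕ} (hn : n ≠ 0) : timeBound n ≤ n ^ 2 * (34 * Nat.clog 2 n + 85) := by
  obtain ⟨m, rfl⟩ := Nat.exists_eq_succ_of_ne_zero hn
  rw [timeBound]
  generalize Nat.clog 2 _ = c
  nlinarith [Nat.zero_le (m * c), Nat.zero_le m]

theorem clog_isBigO_log {b : ℕ} (hb : 1 < b) :
    (fun n : ℕ => (Nat.clog b n : ℝ)) =O[atTop] fun n : ℕ => Real.log n := by
  simp only [← Real.natCeil_logb_natCast]
  have hlogb : Tendsto (Real.logb b) atTop atTop := Real.tendsto_logb_atTop (mod_cast hb)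
  exact ((isEquivalent_nat_ceil.isBigO.comp_tendsto hlogb).trans
    (Real.isBigO_logb_log.mono le_top)).comp_tendsto tendsto_natCast_atTop_atTop

theorem timeBound_isBigO :
    (fun n : ℕ => (timeBound n : ℝ)) =O[atTop] fun n : ℕ => (n : ℝ) ^ 2 * Real.log n := by
  have hone : (fun _ : ℕ => (85 : ℝ)) =O[atTop] fun n : ℕ => Real.log n :=
    ((Real.isLittleO_const_log_atTop).comp_tendsto tendsto_natCast_atTop_atTop).isBigO
  refine .trans (.of_bound' ?_)
    ((isBigO_refl (fun n : ℕ => (n : ℝ) ^ 2) atTop).mul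
      (((clog_isBigO_log one_lt_two).const_mul_left 34).add hone))
  filter_upwards [eventually_ne_atTop 0] with n hn
  rw [Real.norm_of_nonneg (by positivity), Real.norm_of_nonneg (by positivity)]
  exact_mod_cast timeBound_le hn

theorem countCrossings_input_spec : WP ((n + 2) ^ 6) countCrossings
    (fun t s => t ≤ timeBound n ∧ s.wreg 0 = G.crossings) (input G) := by
  have hW : n * (n * (2 * (n * n))) + n * (n * n) + 2 * n + 8 < (n + 2) ^ 6 := by
    ring_nf
    lia
  refine (countCrossings_spec (n := n) (a := inputAdj G) (P := inputPoint G) rfl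
    (fun i hi => if_neg hi) (fun _ _ _ _ => rfl) (fun _ _ => rfl) (fun _ _ => rfl)
    (fun v _ u _ => inputAdj_le_one G v u) ?_ hW).mono ?_
  · intro v hv w hw hwv u hu huw
    exact inputAdj_eq_zero_of_slopeKey_eq G (v := ⟨v, hv⟩) (w := ⟨w, hw⟩) (u := ⟨u, hu⟩)
      (by simpa [Fin.ext_iff] using hwv.symm) (by simpa [Fin.ext_iff] using huw.symm)
  · rintro t s ⟨ht, hs⟩
    refine ⟨ht, ?_⟩
    rw [hs, sum_samePairs, Nat.add_sub_cancel_left, Nat.add_sub_cancel_left,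
      Nat.mul_div_cancel_left _ (by norm_num)]

end RealRAM

/-- There is one real RAM program that, for every `n` and every geometric graph `G` on `n` vertices,
halts with the number of crossings of `G` in word register `0`, in `O(n ^ 2 * log n)` time, using
words of `O(log n)` bits. -/
theorem mainTheorem1 :
    ∃ (p : RealRAM.Program) (c : ℕ) (T : ℕ → ℕ),
      ((fun n : ℕ => (T n : ℝ)) =O[atTop] fun n : ℕ => (n : ℝ) ^ 2 * Real.log (n : ℝ)) ∧
      ∀ (n : ℕ) (G : GeometricGraph n), ∃ (t : ℕ) (s : RealRAM.State),
        RealRAM.Runs ((n + 2) ^ c) p (RealRAM.input G) t s ∧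
        t ≤ T n ∧
        s.wreg 0 = G.crossings := by
  exact ⟨RealRAM.countCrossings, 6, RealRAM.timeBound, RealRAM.timeBound_isBigO,
    fun _ G => RealRAM.countCrossings_input_spec G⟩
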